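/- Conventions. Let $P$ be a finite poset with minimum $\hat 0$ and maximum $\hat 1$ that is graded, i.e. $\mathrm{rank}(F)$ is the length of every maximal chain from $\hat 0$ to $F$; let $n=\mathrm{rank}(\hat 1)$ be its rank. An edge labeling $\lambda$ assigns a nonnegative integer to every cover relation of $P$. It is an $R$-labeling if every interval of $P$ contains exactly one maximal chain along which the labels are weakly increasing. For a maximal chain $\mathcal F=\{\mathcal F_0\prec\dots\prec\mathcal F_n\}$ from $\hat 0$ to $\hat 1$ put $\lambda_i=\lambda(\mathcal F_{i-1}\prec\mathcal F_i)$, $\mathrm{Des}(\mathcal F)=\{1\le i\le n-1 \mid \lambda_i>\lambda_{i+1}\}$ and $\mathrm{des}(\mathcal F)=|\mathrm{Des}(\mathcal F)|$. The set $\mathrm{Des}(\mathcal F)$ is isolated if $i\in\mathrm{Des}(\mathcal F)$ implies $i+1\notin\mathrm{Des}(\mathcal F)$. For a loopless matroid $M$ on a finite ground set $E$, the augmented Chow ring $\mathrm{CH}(M)$ is the quotient of $\mathbb Q[x_F, y_i \mid F \text{ a flat}, F\neq E,\ i\in E]$, with all variables in degree $1$, by the ideal generated by $y_i-\sum_{F\not\ni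 i}x_F$ for $i\in E$, by $x_Fx_G$ for incomparable $F,G$, and by $y_ix_F$ for $i\notin F$. The augmented Chow polynomial of $M$ is its Hilbert–Poincaré series $\mathsf H_M(x)=\sum_{d\ge 0}\dim_{\mathbb Q}\mathrm{CH}^d(M)\,x^d$. For a finite graded poset $P$ with Möbius function $\mu$ and $a<b$ in $P$ let $$\overline\chi_{[a,b]}(x)=\frac{1}{x-1}\sum_{a\le z\le b}\mu(a,z)\,x^{\mathrm{rank}(b)-\mathrm{rank}(z)}.$$ The augmented Chow polynomial of $P$ is $$\mathsf H_P(x)=\sum_{\mathcal C_1<\dots<\mathcal C_k<\mathcal C_{k+1}=\hat 1} x^{\mathrm{rank}(\mathcal C_1)}\prod_{i=1}^{k}\overline\chi_{[\mathcal C_i,\mathcal C_{i+1}]}(x),$$ the sum being over all chains in $P$ that end in $\hat 1$ ($k\ge 0$). Theorem. (1) Let $M$ be a loopless matroid of rank $n$ on a finite ground set, and let $\lambda$ be an $R$-labeling of its lattice of flats $\mathcal L(M)$. Then $$\mathsf H_M(x)=\sum_{\mathcal F}x^{\mathrm{des}(\mathcal F)}(x+1)^{n-2\,\mathrm{des}(\mathcal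 F)},$$ where the sum ranges over all maximal chains $\mathcal F$ in $\mathcal L(M)$ such that $\mathrm{Des}(\mathcal F)$ is isolated. (2) Let $P$ be a finite graded poset of rank $n$ with an $R$-labeling $\lambda$. Then $$\mathsf H_P(x)=\sum_{\mathcal F}x^{\mathrm{des}(\mathcal F)}(x+1)^{n-2\,\mathrm{des}(\mathcal F)},$$ where the sum ranges over all maximal chains $\mathcal F$ in $P$ such that $\mathrm{Des}(\mathcal F)$ is isolated. -/

import Mathlib

open scoped Polynomial

/-! ### Saturated chains, edge labelings, descents -/

namespace ChainPoset

section Chains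

variable {P : Type*} [PartialOrder P]

/-- `c 0 ⋖ c 1 ⋖ ⋯ ⋖ c m` is a maximal chain of the interval `[a, b]`. -/
structure IsMaxChain (a b : P) {m : ℕ} (c : Fin (m + 1) → P) : Prop where
  head_eq : c 0 = a
  last_eq : c (Fin.last m) = b
  covBy : ∀ i : Fin m, c i.castSucc ⋖ c i.succ

/-- The label `lam_i = lam (c (i - 1) ⋖ c i)` along a chain `c 0 ⋖ ⋯ ⋖ c m`, for `1 ≤ i ≤ m`
(only these `i` are ever used). -/
def chainLabel (lam : P → P → ℕ) {m : ℕ} (c : Fin (m + 1) → P) (i : ℕ) : ℕ :=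
  lam (c (Fin.ofNat (m + 1) (i - 1))) (c (Fin.ofNat (m + 1) i))

/-- The descent set `{i ∈ {1, …, m - 1} | lam_i > lam_{i+1}}` of a chain `c 0 ⋖ ⋯ ⋖ c m`. -/
def Des (lam : P → P → ℕ) {m : ℕ} (c : Fin (m + 1) → P) : Finset ℕ :=
  {i ∈ Finset.Ico 1 m | chainLabel lam c (i + 1) < chainLabel lam c i}

/-- The number of descents. -/
def des (lam : P → P → ℕ) {m : ℕ} (c : Fin (m + 1) → P) : ℕ := (Des lam c).card

/-- A set of positions is isolated if it does not contain two consecutive positions. -/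
def IsIsolated (S : Finset ℕ) : Prop := ∀ i ∈ S, i + 1 ∉ S

/-- The labels weakly increase along the chain `c 0 ⋖ ⋯ ⋖ c m`. -/
def IsIncreasing (lam : P → P → ℕ) {m : ℕ} (c : Fin (m + 1) → P) : Prop :=
  ∀ i ∈ Finset.Ico 1 m, chainLabel lam c i ≤ chainLabel lam c (i + 1)

/-- An `R`-labeling: every interval has exactly one maximal chain along which the labels weakly
increase. The edge labeling is a function of two arguments of which only the values on cover
relations matter; a chain is a pair of its length and its sequence of elements. -/
def IsRLabeling (lam : P → P → ℕ) : Prop :=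
  ∀ a b : P, a ≤ b →
    ∃! c : Σ m : ℕ, (Fin (m + 1) → P), IsMaxChain a b c.2 ∧ IsIncreasing lam c.2

open scoped Classical in
/-- `∑ x ^ des(c) * (x + 1) ^ (n - 2 des(c))` over the maximal chains `c` from `⊥` to `⊤` of
length `n` whose descent set is isolated. -/
noncomputable def isolatedDescentSum [BoundedOrder P] [Fintype P] (n : ℕ) (lam : P → P → ℕ) :
    ℤ[X] :=
  ∑ c : Fin (n + 1) → P with IsMaxChain ⊥ ⊤ c ∧ IsIsolated (Des lam c),
    Polynomial.X ^ des lam c * (Polynomial.X + 1) ^ (n - 2 * des lam c)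

end Chains

/-! ### The augmented Chow polynomial of a finite graded poset -/

section Chow

variable {P : Type*} [PartialOrder P] [BoundedOrder P] [Fintype P] [LocallyFiniteOrder P]
  [DecidableEq P] [GradeMinOrder ℕ P]

/-- The characteristic polynomial of the interval `[a, b]`, whose rank function is
`z ↦ rank z - rank a`, whose rank is `rank b - rank a`, and whose Möbius function is that of `P`. -/
noncomputable def intervalCharpoly (a b : P) : ℤ[X] :=
  ∑ z ∈ Finset.Icc a b,
    Polynomial.C (IncidenceAlgebra.mu ℤ a z) * Polynomial.X ^ (grade ℕ b - grade ℕ z)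

/-- The reduced characteristic polynomial of `[a, b]`, `a < b`: the (exact) quotient of the
characteristic polynomial by `x - 1`. -/
noncomputable def reducedCharpoly (a b : P) : ℤ[X] :=
  intervalCharpoly a b /ₘ (Polynomial.X - Polynomial.C 1)

variable (P) in
open scoped Classical in
/-- The augmented Chow polynomial: the sum, over all chains `c 0 < ⋯ < c k = ⊤` with arbitrary
starting point, of `x ^ rank (c 0)` times the product of the reduced characteristic polynomials of
the intervals `[c i, c (i + 1)]`. Chains have `k ≤ rank P`. If `rank P = 0`, the only chain is
`{⊤}` and the value is `1`. -/
noncomputable def augmentedChowPolynomial : ℤ[X] :=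
  ∑ k ∈ Finset.range (grade ℕ (⊤ : P) + 1),
    ∑ c : Fin (k + 1) → P with StrictMono c ∧ c (Fin.last k) = ⊤,
      Polynomial.X ^ grade ℕ (c 0) * ∏ i : Fin k, reducedCharpoly (c i.castSucc) (c i.succ)

end Chow

end ChainPoset

/-! ### Lattice of flats and augmented Chow ring of a matroid -/

namespace Matroid

variable {α : Type*} (M : Matroid α)

/-- The lattice of flats, ordered by inclusion. -/
abbrev Flats : Type _ := {F : Set α // M.IsFlat F}

instance instBoundedOrderFlats : BoundedOrder M.Flats where
  top := ⟨M.E, M.ground_isFlat⟩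
  le_top F := F.2.subset_ground
  bot := ⟨M.closure ∅, M.isFlat_closure ∅⟩
  bot_le F := F.2.loops_subset

instance instFiniteFlats [M.Finite] : Finite M.Flats :=
  (M.ground_finite.finite_subsets.subset
    (fun F (hF : M.IsFlat F) => hF.subset_ground) : {F : Set α | M.IsFlat F}.Finite)

noncomputable instance instFintypeFlats [M.Finite] : Fintype M.Flats := Fintype.ofFinite _

/-- The flats of `M` other than the ground set. -/
abbrev ProperFlats : Type _ := {F : M.Flats // F ≠ ⊤}

instance instFiniteProperFlats [M.Finite] : Finite M.ProperFlats :=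
  inferInstanceAs (Finite {F : M.Flats // F ≠ ⊤})

noncomputable instance instFintypeProperFlats [M.Finite] : Fintype M.ProperFlats :=
  Fintype.ofFinite _

/-- The polynomial ring `ℚ[x_F, y_i]` with `F` a proper flat and `i ∈ E`. -/
abbrev ChowVars : Type _ := MvPolynomial (M.ProperFlats ⊕ M.E) ℚ

/-- The variable `x_F` of a proper flat `F`. -/
noncomputable def chowX (F : M.ProperFlats) : M.ChowVars := MvPolynomial.X (Sum.inl F)

/-- The variable `y_i` of an element `i` of the ground set. -/
noncomputable def chowY (i : M.E) : M.ChowVars := MvPolynomial.X (Sum.inr i)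

open scoped Classical in
/-- The ideal of relations of the augmented Chow ring, generated by `y_i - ∑_{F ∌ i} x_F`,
by `x_F * x_G` for incomparable `F` and `G`, and by `y_i * x_F` for `i ∉ F`. -/
noncomputable def augmentedChowIdeal [M.Finite] : Ideal M.ChowVars :=
  Ideal.span
    ({p | ∃ i : M.E, p = M.chowY i - ∑ F : M.ProperFlats with (i : α) ∉ F.1.1, M.chowX F} ∪
     {p | ∃ F G : M.ProperFlats, ¬ F ≤ G ∧ ¬ G ≤ F ∧ p = M.chowX F * M.chowX G} ∪
     {p | ∃ (i : M.E) (F : M.ProperFlats), (i : α) ∉ F.1.1 ∧ p = M.chowY i * M.chowX F})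

/-- The augmented Chow ring of `M`. -/
abbrev AugmentedChowRing [M.Finite] : Type _ := M.ChowVars ⧸ M.augmentedChowIdeal

/-- The degree `d` part of the augmented Chow ring: all variables have degree `1`, and the ideal
of relations is homogeneous. -/
noncomputable def augmentedChowGraded [M.Finite] (d : ℕ) : Submodule ℚ M.AugmentedChowRing :=
  (MvPolynomial.homogeneousSubmodule (M.ProperFlats ⊕ M.E) ℚ d).map
    (Ideal.Quotient.mkₐ ℚ M.augmentedChowIdeal).toLinearMap

/-- The Hilbert–Poincaré series `∑ dim_ℚ(CH^d) x^d` of the augmented Chow ring `CH` of `M`. -/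
noncomputable def augmentedChowSeries [M.Finite] : PowerSeries ℤ :=
  PowerSeries.mk fun d => (Module.finrank ℚ (M.augmentedChowGraded d) : ℤ)

end Matroid

/-!
The two parts share a combinatorial core. For a poset `P` with rank function `rk`, let `p` be the
solution of `∑_{b ≥ a} (x - x ^ rank [a, b]) p(b) = x - 1` for all `a` (`IsChowFunction`).

*`R`-labelings.* Let `A` and `D` be the matrices, indexed by the cover relations of `P`, of the
ascents and descents at consecutive covers. As every interval has exactly one increasing maximal
chain, the zeta function weighted by `q ^ rank` is a sum over increasing chains, that is, a
geometric series in `q A`. Hence it is inverted by the series in `-q D` (`sum_zeta_eq`). A chain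
with isolated descents is a sequence of single steps of weight `x + 1` and double steps `u ⋖ v ⋖ w`
with a descent at `v` of weight `x`, separated by ascents. Let `h(a)` be the sum over such chains
from `a` to `⊤`. Inverting `h` by the zeta functions of weights `x` and `1` and comparing the
results shows that `h(a) = ∑_{b ≥ a} x ^ rank [a, b] p(b)` (`exists_isChowFunction`).

*The Chow polynomial of a poset.* Möbius inversion of the defining equation of `p` yields the
recursion `p(a) = ∑_{b > a} χ(a, b) p(b)` for `a < ⊤` with `χ` the reduced characteristic
polynomial, so that `∑_b x ^ rk b p(b)` is the augmented Chow polynomial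
(`IsChowFunction.augmentedChowPolynomial_eq`).

*The Hilbert series of a matroid.* Solving the defining equation for `p(a)` instead shows that
`∑_b x ^ rk b p(b)` enumerates the standard monomials by degree: the monomials in the flats,
supported on a chain, whose exponents are bounded by the rank gaps
(`IsChowFunction.sum_pow_mul_eq`). It remains to see that these form a basis of the augmented Chow
ring. Let `h_F` be the sum of the `x_G` over the proper flats `G` not containing `F`; then
`h_⊥ = 0`, and `y_i = h_{cl i}`.

* They span: `(h_F - h_{F ⊔ G}) (h_G - h_{F ⊔ G}) = 0`, and `h_F h_G ^ k = h_G ^ (k + 1)` for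
  `F ≤ G` and `k = rk G - rk F`. These relations rewrite a nonstandard monomial into
  monomials with a larger sum of ranks (`simplicialMap_monomial_mem`).
* They are independent: let a linear functional take the value `1` at a monomial in the `h_F` if all
  its submonomials `u` satisfy `deg u ≤ rk (⋁ u)` (the Hall–Rado condition), and `0` otherwise.
  Submodularity of the rank implies that it vanishes on the ideal of relations
  (`augmentedChowIdeal_le_comap`). The functions `w ↦ [m * w satisfies the Hall–Rado condition]`,
  for `m` standard of fixed degree, are linearly independent: the flats that destroy the condition
  for a given `m * w` form a principal ideal, and separating the relation according to the generator
  of this ideal reduces it to a relation below a smaller flat (`eq_zero_of_sum_hallRado_eq_zero`).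
-/

/-! ### Chains with a prepended element, and increasing chains -/

namespace ChainPoset

section ChainCons

variable {P : Type*}

lemma ofNat_succ_eq_succ {m i : ℕ} (hi : i ≤ m) :
    Fin.ofNat (m + 1 + 1) (i + 1) = (Fin.ofNat (m + 1) i).succ := by
  ext
  simp [Fin.ofNat, Nat.mod_eq_of_lt (show i < m + 1 by omega),
    Nat.mod_eq_of_lt (show i + 1 < m + 1 + 1 by omega)]

lemma chainLabel_cons_succ (lam : P → P → ℕ) {m i : ℕ} (u : P) (c : Fin (m + 1) → P)
    (hi : 1 ≤ i) (him : i ≤ m) :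
    chainLabel lam (Fin.cons u c : Fin (m + 1 + 1) → P) (i + 1) = chainLabel lam c i := by
  obtain ⟨j, rfl⟩ : ∃ j, i = j + 1 := ⟨i - 1, by omega⟩
  simp only [chainLabel, Nat.add_sub_cancel]
  rw [ofNat_succ_eq_succ him, ofNat_succ_eq_succ (by omega : j ≤ m), Fin.cons_succ, Fin.cons_succ]

lemma chainLabel_cons_one (lam : P → P → ℕ) {m : ℕ} (u : P) (c : Fin (m + 1) → P) :
    chainLabel lam (Fin.cons u c : Fin (m + 1 + 1) → P) 1 = lam u (c 0) := by
  have := ofNat_succ_eq_succ (Nat.zero_le m)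
  simp only [chainLabel]
  rw [this, Fin.cons_succ]
  rfl

lemma chainLabel_cons_cons_two (lam : P → P → ℕ) {m : ℕ} (u v : P) (c : Fin (m + 1) → P) :
    chainLabel lam (Fin.cons u (Fin.cons v c : Fin (m + 1 + 1) → P) : Fin (m + 1 + 1 + 1) → P) 2
      = lam v (c 0) := by
  rw [chainLabel_cons_succ lam u _ le_rfl (by omega), chainLabel_cons_one]

lemma notMem_Des_zero (lam : P → P → ℕ) {m : ℕ} (c : Fin (m + 1) → P) : 0 ∉ Des lam c := by
  simp [Des]

lemma one_mem_Des_cons_cons {lam : P → P → ℕ} {m : ℕ} {u v : P} {c : Fin (m + 1) → P} :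
    1 ∈ Des lam (Fin.cons u (Fin.cons v c : Fin (m + 1 + 1) → P) : Fin (m + 1 + 1 + 1) → P) ↔
      lam v (c 0) < lam u v := by
  simp only [Des, Finset.mem_filter, Finset.mem_Ico]
  rw [chainLabel_cons_cons_two, chainLabel_cons_one]
  simp

lemma succ_mem_Des_cons {lam : P → P → ℕ} {m i : ℕ} {u : P} {c : Fin (m + 1) → P} (hi : 1 ≤ i) :
    i + 1 ∈ Des lam (Fin.cons u c : Fin (m + 1 + 1) → P) ↔ i ∈ Des lam c := by
  simp only [Des, Finset.mem_filter, Finset.mem_Ico]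
  constructor
  · rintro ⟨⟨-, h⟩, h2⟩
    rw [chainLabel_cons_succ lam u c (by omega) (by omega),
      chainLabel_cons_succ lam u c (by omega) (by omega)] at h2
    exact ⟨⟨hi, by omega⟩, h2⟩
  · rintro ⟨⟨-, h⟩, h2⟩
    rw [chainLabel_cons_succ lam u c (by omega) (by omega),
      chainLabel_cons_succ lam u c (by omega) (by omega)]
    exact ⟨⟨by omega, by omega⟩, h2⟩

lemma Des_cons (lam : P → P → ℕ) {m : ℕ} (u : P) (c : Fin (m + 1) → P)
    [Decidable (1 ∈ Des lam (Fin.cons u c : Fin (m + 1 + 1) → P))] :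
    Des lam (Fin.cons u c : Fin (m + 1 + 1) → P) =
      (if 1 ∈ Des lam (Fin.cons u c : Fin (m + 1 + 1) → P) then {1} else ∅) ∪
        (Des lam c).map (addRightEmbedding 1) := by
  ext i
  match i with
  | 0 =>
    have := notMem_Des_zero lam (Fin.cons u c : Fin (m + 1 + 1) → P)
    split_ifs <;> simp [this]
  | 1 =>
    have := notMem_Des_zero lam c
    split_ifs with h <;> simp [h, this]
  | i + 2 =>
    rw [succ_mem_Des_cons (by omega)]
    split_ifs <;> simp

lemma des_cons_of_notMem {lam : P → P → ℕ} {m : ℕ} {u : P} {c : Fin (m + 1) → P}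
    (h : 1 ∉ Des lam (Fin.cons u c : Fin (m + 1 + 1) → P)) :
    des lam (Fin.cons u c : Fin (m + 1 + 1) → P) = des lam c := by
  classical
  rw [des, Des_cons, if_neg h]
  simp [des]

lemma des_cons_of_mem {lam : P → P → ℕ} {m : ℕ} {u : P} {c : Fin (m + 1) → P}
    (h : 1 ∈ Des lam (Fin.cons u c : Fin (m + 1 + 1) → P)) :
    des lam (Fin.cons u c : Fin (m + 1 + 1) → P) = des lam c + 1 := by
  classical
  rw [des, Des_cons, if_pos h, Finset.card_union_of_disjoint, Finset.card_map]
  · simp [des, add_comm]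
  · simp [notMem_Des_zero lam c]

lemma isIsolated_Des_cons_iff {lam : P → P → ℕ} {m : ℕ} {u : P} {c : Fin (m + 1) → P} :
    IsIsolated (Des lam (Fin.cons u c : Fin (m + 1 + 1) → P)) ↔
      IsIsolated (Des lam c) ∧
        (1 ∈ Des lam (Fin.cons u c : Fin (m + 1 + 1) → P) → 1 ∉ Des lam c) := by
  constructor
  · intro h
    refine ⟨fun i hi hi' => ?_, fun h1 h2 => h 1 h1 ((succ_mem_Des_cons le_rfl).2 h2)⟩
    have hi1 : 1 ≤ i := Nat.one_le_iff_ne_zero.2 fun h0 => notMem_Des_zero lam c (h0 ▸ hi)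
    exact h (i + 1) ((succ_mem_Des_cons hi1).2 hi) ((succ_mem_Des_cons (by omega)).2 hi')
  · rintro ⟨h1, h2⟩ i hi hi'
    match i with
    | 0 => exact notMem_Des_zero lam _ hi
    | 1 => exact h2 hi ((succ_mem_Des_cons le_rfl).1 hi')
    | i + 2 => exact h1 (i + 1) ((succ_mem_Des_cons (by omega)).1 hi)
                ((succ_mem_Des_cons (by omega)).1 hi')

lemma two_mul_des_le {lam : P → P → ℕ} {m : ℕ} {c : Fin (m + 1) → P}
    (h : IsIsolated (Des lam c)) : 2 * des lam c ≤ m := by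
  have hd : Disjoint (Des lam c) ((Des lam c).map (addRightEmbedding 1)) := by
    rw [Finset.disjoint_left]
    intro i hi hi'
    obtain ⟨j, hj, rfl⟩ := Finset.mem_map.1 hi'
    exact h j hj hi
  have hsub : Des lam c ∪ (Des lam c).map (addRightEmbedding 1) ⊆ Finset.Ioc 0 m := by
    intro i hi
    rcases Finset.mem_union.1 hi with hi | hi
    · simp only [Des, Finset.mem_filter, Finset.mem_Ico] at hi
      simp; omega
    · obtain ⟨j, hj, rfl⟩ := Finset.mem_map.1 hi
      simp only [Des, Finset.mem_filter, Finset.mem_Ico] at hj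
      simp; omega
  have := Finset.card_le_card hsub
  rw [Finset.card_union_of_disjoint hd, Finset.card_map] at this
  simp only [Nat.card_Ioc] at this
  simp only [des]
  omega

lemma isIncreasing_iff_Des_eq_empty {lam : P → P → ℕ} {m : ℕ} {c : Fin (m + 1) → P} :
    IsIncreasing lam c ↔ ∀ i, i ∉ Des lam c := by
  simp only [IsIncreasing, Des, Finset.mem_filter, not_and, not_lt]

lemma isIncreasing_cons {lam : P → P → ℕ} {m : ℕ} {u : P} {c : Fin (m + 1) → P} :
    IsIncreasing lam (Fin.cons u c : Fin (m + 1 + 1) → P) ↔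
      1 ∉ Des lam (Fin.cons u c : Fin (m + 1 + 1) → P) ∧ IsIncreasing lam c := by
  simp only [isIncreasing_iff_Des_eq_empty]
  constructor
  · intro h
    refine ⟨h 1, fun i hi => ?_⟩
    have hi1 : 1 ≤ i := Nat.one_le_iff_ne_zero.2 fun h0 => notMem_Des_zero lam c (h0 ▸ hi)
    exact h (i + 1) ((succ_mem_Des_cons hi1).2 hi)
  · rintro ⟨h1, h2⟩ i hi
    match i with
    | 0 => exact notMem_Des_zero lam _ hi
    | 1 => exact h1 hi
    | i + 2 => exact h2 (i + 1) ((succ_mem_Des_cons (by omega)).1 hi)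

lemma exists_cons {m : ℕ} (c : Fin (m + 1 + 1) → P) :
    ∃ (u : P) (c' : Fin (m + 1) → P), c = Fin.cons u c' :=
  ⟨c 0, Fin.tail c, (Fin.cons_self_tail c).symm⟩

lemma sum_fin_cons {M : Type*} [AddCommMonoid M] [Fintype P] {m : ℕ}
    (f : (Fin (m + 1 + 1) → P) → M) :
    ∑ c, f c = ∑ u : P, ∑ c : Fin (m + 1) → P, f (Fin.cons u c) := by
  rw [← Fintype.sum_prod_type']
  exact (Fintype.sum_equiv (Fin.consEquiv fun _ : Fin (m + 1 + 1) => P) _ _ fun _ => rfl).symm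

variable [PartialOrder P]

lemma isMaxChain_cons {a b u : P} {m : ℕ} {c : Fin (m + 1) → P} :
    IsMaxChain a b (Fin.cons u c : Fin (m + 1 + 1) → P) ↔
      u = a ∧ u ⋖ c 0 ∧ IsMaxChain (c 0) b c := by
  constructor
  · rintro ⟨h0, h1, h2⟩
    refine ⟨by simpa using h0, by simpa using h2 0, rfl, ?_, fun i => ?_⟩
    · rw [← h1, ← Fin.succ_last, Fin.cons_succ]
    · have := h2 i.succ
      rwa [Fin.cons_succ, Fin.castSucc_succ, Fin.cons_succ] at this
  · rintro ⟨rfl, h, -, h1, h2⟩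
    refine ⟨rfl, ?_, fun i => ?_⟩
    · rw [← h1, ← Fin.succ_last, Fin.cons_succ]
    · refine Fin.cases ?_ (fun j => ?_) i
      · simpa using h
      · rw [Fin.cons_succ, Fin.castSucc_succ, Fin.cons_succ]
        exact h2 j

lemma isMaxChain_zero {a b : P} {c : Fin 1 → P} :
    IsMaxChain a b c ↔ c 0 = a ∧ a = b :=
  ⟨fun h => ⟨h.head_eq, h.head_eq.symm.trans h.last_eq⟩,
    fun h => ⟨h.1, h.1.trans h.2, fun i => i.elim0⟩⟩

lemma IsMaxChain.le {a b : P} {m : ℕ} {c : Fin (m + 1) → P} (h : IsMaxChain a b c) : a ≤ b := by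
  have hm : Monotone c := Fin.monotone_iff_le_succ.2 fun i => (h.covBy i).le
  rw [← h.head_eq, ← h.last_eq]
  exact hm (Fin.zero_le _)

/-- The second element of the increasing maximal chain of each interval of a poset with an
`R`-labeling. An increasing chain from `u` through a cover `v` of `u` is an increasing chain from
`v` whose first label is at least `lam u v`. -/
lemma IsRLabeling.exists_second {lam : P → P → ℕ} (h : IsRLabeling lam) :
    ∃ snd : P → P → P, (∀ u b, u < b → u ⋖ snd u b ∧ snd u b ≤ b) ∧
      ∀ u v b, u ⋖ v → v < b → (snd u b = v ↔ lam u v ≤ lam v (snd v b)) := by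
  classical
  have key : ∀ u b : P, u < b → ∃ v, u ⋖ v ∧ v ≤ b ∧
      (∃ (m : ℕ) (c : Fin (m + 1) → P), IsMaxChain v b c ∧
        IsIncreasing lam (Fin.cons u c : Fin (m + 1 + 1) → P)) ∧
      ∀ (m : ℕ) (c : Fin (m + 1) → P), u ⋖ c 0 → IsMaxChain (c 0) b c →
        IsIncreasing lam (Fin.cons u c : Fin (m + 1 + 1) → P) → c 0 = v := by
    intro u b hub
    obtain ⟨⟨m, c⟩, ⟨hc, hi⟩, hu⟩ := h u b hub.le
    dsimp only at hc hi
    match m with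
    | 0 => exact absurd (isMaxChain_zero.1 hc).2 hub.ne
    | m + 1 =>
      obtain ⟨a, c, rfl⟩ := exists_cons c
      obtain ⟨rfl, hac, hc'⟩ := isMaxChain_cons.1 hc
      refine ⟨c 0, hac, hc'.le, ⟨m, c, hc', hi⟩, fun m' c' h1 h2 h3 => ?_⟩
      have := hu ⟨m' + 1, Fin.cons a c'⟩ ⟨isMaxChain_cons.2 ⟨rfl, h1, h2⟩, h3⟩
      obtain ⟨h4, h5⟩ := Sigma.mk.inj_iff.1 this
      obtain rfl : m' = m := by omega
      rw [(Fin.cons_injective2 (eq_of_heq h5)).2]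
  choose! snd hcov hle hex huniq using key
  refine ⟨snd, fun u b hub => ⟨hcov u b hub, hle u b hub⟩, fun u v b huv hvb => ?_⟩
  obtain ⟨m, c, hc, hi⟩ := hex v b hvb
  have hinc : IsIncreasing lam (Fin.cons u (Fin.cons v c : Fin (m + 1 + 1) → P) :
      Fin (m + 1 + 1 + 1) → P) ↔ lam u v ≤ lam v (snd v b) := by
    rw [isIncreasing_cons, one_mem_Des_cons_cons, hc.head_eq, not_lt]
    exact and_iff_left hi
  rw [← hinc]
  have hvc : IsMaxChain v b (Fin.cons v c : Fin (m + 1 + 1) → P) :=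
    isMaxChain_cons.2 ⟨rfl, by rw [hc.head_eq]; exact hcov v b hvb, by rwa [hc.head_eq]⟩
  constructor
  · intro hs
    obtain ⟨m', c', hc', hi'⟩ := hex u b (huv.lt.trans hvb)
    rw [hs] at hc'
    have := (h v b hvb.le).unique (y₁ := ⟨m', c'⟩) (y₂ := ⟨m + 1, Fin.cons v c⟩)
      ⟨hc', (isIncreasing_cons.1 hi').2⟩ ⟨hvc, hi⟩
    obtain ⟨h4, h5⟩ := Sigma.mk.inj_iff.1 this
    subst h4
    rwa [eq_of_heq h5] at hi'
  · intro hs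
    exact (huniq u b (huv.lt.trans hvb) (m + 1) (Fin.cons v c) huv hvc hs).symm

end ChainCons

end ChainPoset

/-! ### Recursions for the sums over chains with isolated descents -/

namespace ChainPoset

section ChainSums

open Polynomial

variable {P : Type*}

lemma Des_eq_empty_of_le_one {lam : P → P → ℕ} {m : ℕ} (hm : m ≤ 1) (c : Fin (m + 1) → P) :
    Des lam c = ∅ := by
  rw [Des, Finset.Ico_eq_empty (by omega), Finset.filter_empty]

variable [PartialOrder P] [BoundedOrder P] [Fintype P]

/-- The summand `x ^ des(c) * (x + 1) ^ (m - 2 des(c))` attached to a chain `c` of length `m`. -/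
noncomputable def desWeight (lam : P → P → ℕ) {m : ℕ} (c : Fin (m + 1) → P) : ℤ[X] :=
  X ^ des lam c * (X + 1) ^ (m - 2 * des lam c)

open scoped Classical in
/-- The sum of the descent weights over the chains from `v` to `⊤` of length `m` with isolated
descent set whose first label is not smaller than `lam u v`. -/
noncomputable def ascentSum (lam : P → P → ℕ) (m : ℕ) (u v : P) : ℤ[X] :=
  ∑ c : Fin (m + 1) → P, if IsMaxChain v ⊤ c ∧ IsIsolated (Des lam c) ∧
    1 ∉ Des lam (Fin.cons u c : Fin (m + 1 + 1) → P) then desWeight lam c else 0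

open scoped Classical in
/-- The sum of the descent weights over the chains `u, v, …, ⊤` of length `m + 1` with isolated
descent set. -/
noncomputable def edgeSum (lam : P → P → ℕ) (m : ℕ) (u v : P) : ℤ[X] :=
  ∑ c : Fin (m + 1) → P, if IsMaxChain v ⊤ c ∧
    IsIsolated (Des lam (Fin.cons u c : Fin (m + 1 + 1) → P)) then
      desWeight lam (Fin.cons u c : Fin (m + 1 + 1) → P) else 0

open scoped Classical in
/-- The sum of the descent weights over the chains from `u` to `⊤` of length `m` with isolated
descent set. -/
noncomputable def vertexSum (lam : P → P → ℕ) (m : ℕ) (u : P) : ℤ[X] :=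
  ∑ c : Fin (m + 1) → P, if IsMaxChain u ⊤ c ∧ IsIsolated (Des lam c) then desWeight lam c else 0

lemma isolatedDescentSum_eq_vertexSum (n : ℕ) (lam : P → P → ℕ) :
    isolatedDescentSum n lam = vertexSum lam n ⊥ := by
  rw [isolatedDescentSum, vertexSum, Finset.sum_filter]
  rfl

open scoped Classical in
lemma sum_fin_one_chain (v : P) (q : (Fin 1 → P) → Prop) (f : (Fin 1 → P) → ℤ[X]) (x : ℤ[X])
    [∀ c, Decidable (IsMaxChain v ⊤ c ∧ q c)] (hq : ∀ c, q c) (hf : ∀ c, f c = x) :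
    ∑ c : Fin 1 → P, (if IsMaxChain v ⊤ c ∧ q c then f c else 0) =
      if v = ⊤ then x else 0 := by
  rw [Fintype.sum_eq_single fun _ => v]
  · refine if_congr ?_ (hf _) rfl
    rw [isMaxChain_zero]
    simp [hq]
  · intro c hc
    refine if_neg fun h => hc ?_
    ext i
    rw [Subsingleton.elim i 0, h.1.head_eq]

open scoped Classical in
lemma vertexSum_zero (lam : P → P → ℕ) (u : P) :
    vertexSum lam 0 u = if u = ⊤ then 1 else 0 :=
  sum_fin_one_chain _ _ _ _
    (fun c => by rw [Des_eq_empty_of_le_one zero_le_one]; simp [IsIsolated])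
    (fun c => by simp [desWeight, des, Des_eq_empty_of_le_one zero_le_one])

open scoped Classical in
lemma ascentSum_zero (lam : P → P → ℕ) (u v : P) :
    ascentSum lam 0 u v = if v = ⊤ then 1 else 0 :=
  sum_fin_one_chain _ _ _ _
    (fun c => by
      rw [Des_eq_empty_of_le_one zero_le_one, Des_eq_empty_of_le_one le_rfl]; simp [IsIsolated])
    (fun c => by simp [desWeight, des, Des_eq_empty_of_le_one zero_le_one])

open scoped Classical in
lemma edgeSum_zero (lam : P → P → ℕ) (u v : P) :
    edgeSum lam 0 u v = (X + 1) * ascentSum lam 0 u v := by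
  rw [ascentSum_zero, mul_ite, mul_one, mul_zero]
  exact sum_fin_one_chain _ _ _ _
    (fun c => by rw [Des_eq_empty_of_le_one le_rfl]; simp [IsIsolated])
    (fun c => by simp [desWeight, des, Des_eq_empty_of_le_one le_rfl])

open scoped Classical in
/-- A sum over chains from `v` splits according to the second element of the chain. -/
lemma sum_chain_succ {m : ℕ} (v : P) (q : (Fin (m + 1 + 1) → P) → Prop)
    (f : (Fin (m + 1 + 1) → P) → ℤ[X]) [∀ c, Decidable (IsMaxChain v ⊤ c ∧ q c)] :
    ∑ c : Fin (m + 1 + 1) → P, (if IsMaxChain v ⊤ c ∧ q c then f c else 0) =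
      ∑ w : P, if v ⋖ w then ∑ c : Fin (m + 1) → P, (if IsMaxChain w ⊤ c ∧ q (Fin.cons v c) then
        f (Fin.cons v c) else 0) else 0 := by
  rw [sum_fin_cons, Fintype.sum_eq_single v]
  · simp_rw [isMaxChain_cons]
    have : ∀ w, (if v ⋖ w then ∑ c : Fin (m + 1) → P, (if IsMaxChain w ⊤ c ∧ q (Fin.cons v c) then
        f (Fin.cons v c) else 0) else 0) = ∑ c : Fin (m + 1) → P,
        if v ⋖ w ∧ IsMaxChain w ⊤ c ∧ q (Fin.cons v c) then f (Fin.cons v c) else 0 := by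
      intro w
      split_ifs with h <;> simp [h]
    simp_rw [this]
    rw [Finset.sum_comm]
    refine Finset.sum_congr rfl fun c _ => ?_
    rw [Fintype.sum_eq_single (c 0)]
    · simp [and_assoc]
    · exact fun w hw => if_neg fun h => hw h.2.1.head_eq.symm
  · intro u hu
    exact Finset.sum_eq_zero fun c _ => if_neg fun h => hu (isMaxChain_cons.1 h.1).1

open scoped Classical in
lemma vertexSum_succ (lam : P → P → ℕ) (m : ℕ) (u : P) :
    vertexSum lam (m + 1) u = ∑ v : P, if u ⋖ v then edgeSum lam m u v else 0 :=
  sum_chain_succ u _ _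

open scoped Classical in
lemma ascentSum_succ (lam : P → P → ℕ) (m : ℕ) (u v : P) :
    ascentSum lam (m + 1) u v =
      ∑ w : P, if v ⋖ w ∧ lam u v ≤ lam v w then edgeSum lam m v w else 0 := by
  rw [ascentSum, sum_chain_succ]
  refine Finset.sum_congr rfl fun w _ => ?_
  by_cases h : v ⋖ w
  · simp only [h, true_and, if_true]
    rw [edgeSum]
    split_ifs with h2
    · refine Finset.sum_congr rfl fun c _ => ite_congr (propext ⟨fun h => ⟨h.1, h.2.1⟩,
        fun h => ⟨h.1, h.2, ?_⟩⟩) (fun _ => rfl) fun _ => rfl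
      rwa [one_mem_Des_cons_cons, h.1.head_eq, not_lt]
    · refine Finset.sum_eq_zero fun c _ => if_neg fun h => h2 ?_
      have := h.2.2
      rwa [one_mem_Des_cons_cons, h.1.head_eq, not_lt] at this
  · simp [h]

open scoped Classical in
/-- A chain with isolated descents starts with an ascent, which contributes a factor `x + 1`, or
with a descent followed by an ascent, which contribute a factor `x`. -/
lemma edgeSum_succ (lam : P → P → ℕ) (m : ℕ) (u v : P) :
    edgeSum lam (m + 1) u v = (X + 1) * ascentSum lam (m + 1) u v +
      X * ∑ w : P, if v ⋖ w ∧ lam v w < lam u v then ascentSum lam m v w else 0 := by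
  have hsplit : edgeSum lam (m + 1) u v = (X + 1) * ascentSum lam (m + 1) u v +
      ∑ c : Fin (m + 1 + 1) → P, if IsMaxChain v ⊤ c ∧
        (1 ∈ Des lam (Fin.cons u c : Fin (m + 1 + 1 + 1) → P) ∧ IsIsolated (Des lam c) ∧
        1 ∉ Des lam c) then desWeight lam (Fin.cons u c : Fin (m + 1 + 1 + 1) → P) else 0 := by
    rw [edgeSum, ascentSum, Finset.mul_sum, ← Finset.sum_add_distrib]
    refine Finset.sum_congr rfl fun c _ => ?_
    rw [isIsolated_Des_cons_iff]
    by_cases h1 : 1 ∈ Des lam (Fin.cons u c : Fin (m + 1 + 1 + 1) → P)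
    · simp [h1]
    · simp only [h1, false_and, and_false, if_false, add_zero, not_false_eq_true, and_true,
        false_implies]
      rw [mul_ite, mul_zero]
      split_ifs with h
      · rw [desWeight, desWeight, des_cons_of_notMem h1,
          show m + 1 + 1 - 2 * des lam c = (m + 1 - 2 * des lam c) + 1 by
            have := two_mul_des_le h.2; omega]
        ring
      · rfl
  rw [hsplit, sum_chain_succ, Finset.mul_sum]
  congr 1
  refine Finset.sum_congr rfl fun w _ => ?_
  by_cases h : v ⋖ w
  · simp only [h, true_and, if_true]
    rw [ascentSum]
    split_ifs with h2
    · rw [Finset.mul_sum]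
      refine Finset.sum_congr rfl fun c _ => ?_
      rw [mul_ite, mul_zero]
      by_cases hc : IsMaxChain w ⊤ c
      · have h3 : 1 ∈ Des lam (Fin.cons u (Fin.cons v c : Fin (m + 1 + 1) → P) :
            Fin (m + 1 + 1 + 1) → P) := by
          rwa [one_mem_Des_cons_cons, hc.head_eq]
        simp only [hc, h3, true_and, isIsolated_Des_cons_iff]
        refine ite_congr (propext (by tauto)) (fun h4 => ?_) fun _ => rfl
        rw [desWeight, desWeight, des_cons_of_mem h3, des_cons_of_notMem h4.2,
          show m + 1 + 1 - 2 * (des lam c + 1) = m - 2 * des lam c by omega]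
        ring
      · simp [hc]
    · rw [mul_zero]
      refine Finset.sum_eq_zero fun c _ => if_neg fun h => h2 ?_
      have := h.2.1
      rwa [one_mem_Des_cons_cons, h.1.head_eq] at this
  · simp [h]

end ChainSums

end ChainPoset

/-! ### Zeta functions and the Chow function -/

namespace ChainPoset

section Zeta

open Polynomial

variable {P : Type*} [PartialOrder P] [Fintype P]

open scoped Classical in
/-- The sum of `q ^ (rk b - rk v) * f b` over the increasing chains that start with the cover
`u ⋖ v`, where `b` is the end of the chain. An increasing chain is determined by its two ends, and
`snd u b` is the second element of the increasing chain from `u` to `b`. -/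
noncomputable def increasingSum (rk : P → ℕ) (snd : P → P → P) (q : ℤ[X]) (f : P → ℤ[X])
    (u v : P) : ℤ[X] :=
  ∑ b : P, if u < b ∧ snd u b = v then q ^ (rk b - rk v) * f b else 0

open scoped Classical in
lemma sum_lt_eq_sum_increasingSum {rk : P → ℕ} (hmono : StrictMono rk)
    (hcov : ∀ a b, a ⋖ b → rk b = rk a + 1) {snd : P → P → P}
    (hsnd : ∀ u b, u < b → u ⋖ snd u b ∧ snd u b ≤ b) (q : ℤ[X]) (f : P → ℤ[X]) (a : P)
    (S : P → Prop) [∀ v, Decidable (a ⋖ v ∧ S v)] [∀ b, Decidable (a < b ∧ S (snd a b))] :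
    ∑ b : P, (if a < b ∧ S (snd a b) then q ^ (rk b - rk a) * f b else 0) =
      q * ∑ v : P, if a ⋖ v ∧ S v then increasingSum rk snd q f a v else 0 := by
  have h1 : ∀ v, (if a ⋖ v ∧ S v then increasingSum rk snd q f a v else 0) =
      ∑ b : P, if a < b ∧ snd a b = v ∧ S v then q ^ (rk b - rk v) * f b else 0 := by
    intro v
    rw [increasingSum]
    split_ifs with hv
    · simp [hv]
    · refine (Finset.sum_eq_zero fun b _ => if_neg ?_).symm
      rintro ⟨h1, rfl, h2⟩
      exact hv ⟨(hsnd a b h1).1, h2⟩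
  simp_rw [h1]
  rw [Finset.sum_comm, Finset.mul_sum]
  refine Finset.sum_congr rfl fun b _ => ?_
  rw [Fintype.sum_eq_single (snd a b) fun v hv => if_neg fun h => hv h.2.1.symm]
  simp only [true_and]
  split_ifs with h
  · have h2 := hsnd a b h.1
    have h3 := hcov _ _ h2.1
    have h4 := hmono.monotone h2.2
    rw [show rk b - rk a = (rk b - rk (snd a b)) + 1 by omega]
    ring
  · simp

open scoped Classical in
/-- An increasing chain through `u ⋖ v` either stops at `v` or continues with a label that is at
least `lam u v`. -/
lemma increasingSum_eq {rk : P → ℕ} (hmono : StrictMono rk)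
    (hcov : ∀ a b, a ⋖ b → rk b = rk a + 1) {lam : P → P → ℕ} {snd : P → P → P}
    (hsnd : ∀ u b, u < b → u ⋖ snd u b ∧ snd u b ≤ b)
    (hlam : ∀ u v b, u ⋖ v → v < b → (snd u b = v ↔ lam u v ≤ lam v (snd v b)))
    (q : ℤ[X]) (f : P → ℤ[X]) {u v : P} (huv : u ⋖ v) :
    increasingSum rk snd q f u v = f v + q * ∑ w : P, if v ⋖ w ∧ lam u v ≤ lam v w then
      increasingSum rk snd q f v w else 0 := by
  rw [← sum_lt_eq_sum_increasingSum hmono hcov hsnd q f v (fun w => lam u v ≤ lam v w),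
    increasingSum,
    Fintype.sum_eq_add_sum_compl v, if_pos, Nat.sub_self, pow_zero, one_mul]
  · congr 1
    refine Eq.symm ((Fintype.sum_eq_add_sum_compl v _).trans ?_)
    rw [if_neg (by simp), zero_add]
    refine Finset.sum_congr rfl fun b hb => Eq.symm (if_congr ⟨?_, ?_⟩ rfl rfl)
    · rintro ⟨h1, h2⟩
      have hvb : v < b := lt_of_le_of_ne (h2 ▸ (hsnd u b h1).2) (by
        rintro rfl; simp at hb)
      exact ⟨hvb, (hlam u v b huv hvb).1 h2⟩
    · rintro ⟨h1, h2⟩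
      exact ⟨huv.lt.trans h1, (hlam u v b huv h1).2 h2⟩
  · have h := hsnd u v huv.lt
    refine ⟨huv.lt, ?_⟩
    by_contra hne
    exact huv.2 h.1.lt (lt_of_le_of_ne h.2 hne)

open scoped Classical in
/-- Inversion of the weighted zeta function through descents: if the edge function `Y` satisfies
`h v = Y u v + q * ∑ Y v w`, summed over the descents `lam u v > lam v w`, then
`h b - q * ∑ Y b v` is the inverse image of `h` under the zeta function weighted by `q`. -/
lemma sum_zeta_eq {rk : P → ℕ} (hmono : StrictMono rk)
    (hcov : ∀ a b, a ⋖ b → rk b = rk a + 1) {lam : P → P → ℕ} {snd : P → P → P}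
    (hsnd : ∀ u b, u < b → u ⋖ snd u b ∧ snd u b ≤ b)
    (hlam : ∀ u v b, u ⋖ v → v < b → (snd u b = v ↔ lam u v ≤ lam v (snd v b)))
    (q : ℤ[X]) (h : P → ℤ[X]) (Y : P → P → ℤ[X])
    (hY : ∀ u v, u ⋖ v →
      h v = Y u v + q * ∑ w : P, if v ⋖ w ∧ lam v w < lam u v then Y v w else 0) (a : P) :
    ∑ b : P, (if a ≤ b then
      q ^ (rk b - rk a) * (h b - q * ∑ v : P, if b ⋖ v then Y b v else 0) else 0) = h a := by
  set f : P → ℤ[X] := fun b => h b - q * ∑ v : P, if b ⋖ v then Y b v else 0 with hf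
  have key : ∀ v u : P, u ⋖ v → increasingSum rk snd q f u v = Y u v := by
    intro v
    induction v using (wellFounded_gt (α := P)).induction with
    | _ v ih =>
      intro u huv
      have h1 : ∀ w, (if v ⋖ w ∧ lam u v ≤ lam v w then increasingSum rk snd q f v w else 0) =
          (if v ⋖ w then Y v w else 0) - if v ⋖ w ∧ lam v w < lam u v then Y v w else 0 := by
        intro w
        by_cases hw : v ⋖ w
        · rcases le_or_gt (lam u v) (lam v w) with hl | hl
          · simp [hw, hl, ih w hw.lt v hw, hl.not_gt]
          · simp [hw, hl, hl.not_ge]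
        · simp [hw]
      rw [increasingSum_eq hmono hcov hsnd hlam q f huv, Finset.sum_congr rfl fun w _ => h1 w,
        Finset.sum_sub_distrib]
      simp only [hf]
      rw [hY u v huv]
      ring
  have h2 := sum_lt_eq_sum_increasingSum hmono hcov hsnd q f a (fun _ => True)
  have h3 : ∀ b, (if a ≤ b then q ^ (rk b - rk a) * f b else 0) =
      (if b = a then f a else 0) + if a < b ∧ True then q ^ (rk b - rk a) * f b else 0 := by
    intro b
    rcases eq_or_ne b a with rfl | hb
    · simp
    · simp [hb, lt_iff_le_and_ne, hb.symm]
  change ∑ b : P, (if a ≤ b then q ^ (rk b - rk a) * f b else 0) = h a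
  rw [Finset.sum_congr rfl fun b _ => h3 b, Finset.sum_add_distrib, h2]
  have h4 : ∀ v, (if a ⋖ v ∧ True then increasingSum rk snd q f a v else 0) =
      if a ⋖ v then Y a v else 0 := by
    intro v
    by_cases hv : a ⋖ v
    · simp [hv, key v a hv]
    · simp [hv]
  rw [Finset.sum_congr rfl fun v _ => h4 v]
  simp [hf]

end Zeta

section Chow

open Polynomial

variable {P : Type*} [PartialOrder P] [BoundedOrder P] [Fintype P]

open scoped Classical in
/-- `p` is the solution of the equation `∑_{b ≥ a} (x - x ^ rank [a, b]) p(b) = x - 1` for all `a`.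
This equation says that `p(⊤) = 1` and determines `p(a)` from the values of `p` above `a`; the
solution is the Chow polynomial of the interval `[a, ⊤]`. -/
def IsChowFunction (rk : P → ℕ) (p : P → ℤ[X]) : Prop :=
  ∀ a, ∑ b : P, (if a ≤ b then (X - X ^ (rk b - rk a)) * p b else 0) = X - 1

open scoped Classical in
/-- The isolated descent sum of an `R`-labeling is obtained from the Chow function by the zeta
function weighted by `x`. If `h` is the vector of isolated descent sums and `D` the transfer
matrix of descents on the cover relations, then `h` is inverted by the two zeta functions with
weights `x` and `1` by means of the edge functions `(1 + D) J` and `(1 + x D) J`, where `J` is the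
ascent sum; the difference of the two is the equation of the Chow function. -/
lemma exists_isChowFunction {rk : P → ℕ} (hmono : StrictMono rk) (hbot : rk ⊥ = 0)
    (hcov : ∀ a b, a ⋖ b → rk b = rk a + 1) {lam : P → P → ℕ} (hR : IsRLabeling lam) :
    ∃ p : P → ℤ[X], IsChowFunction rk p ∧
      isolatedDescentSum (rk ⊤) lam = ∑ b : P, X ^ rk b * p b := by
  obtain ⟨snd, hsnd, hlam⟩ := hR.exists_second
  set h : P → ℤ[X] := fun u => vertexSum lam (rk ⊤ - rk u) u with hh
  set J : P → P → ℤ[X] := fun u v => ascentSum lam (rk ⊤ - rk v) u v with hJ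
  set I : P → P → ℤ[X] := fun u v => edgeSum lam (rk ⊤ - rk v) u v with hI
  have hlt : ∀ v : P, v ≠ ⊤ → rk v < rk ⊤ := fun v hv => hmono hv.lt_top
  have hntop : ∀ w : P, ¬ (⊤ : P) ⋖ w := fun w hw => not_top_lt hw.lt
  have hpred : ∀ v w : P, v ⋖ w → rk ⊤ - rk v - 1 = rk ⊤ - rk w := fun v w hvw => by
    have := hcov v w hvw; omega
  have hJrec : ∀ u v, J u v = (if v = ⊤ then 1 else 0) +
      ∑ w : P, if v ⋖ w ∧ lam u v ≤ lam v w then I v w else 0 := by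
    intro u v
    by_cases hv : v = ⊤
    · subst hv
      simp [hJ, ascentSum_zero, hntop]
    · obtain ⟨m, hm⟩ : ∃ m, rk ⊤ - rk v = m + 1 := ⟨rk ⊤ - rk v - 1, by have := hlt v hv; omega⟩
      simp only [hJ, hI, hm, ascentSum_succ, hv, if_false, zero_add]
      refine Finset.sum_congr rfl fun w _ => ite_congr rfl (fun hw => ?_) fun _ => rfl
      rw [← hpred v w hw.1, hm, Nat.add_sub_cancel]
  have hIrec : ∀ u v, I u v = (X + 1) * J u v +
      X * ∑ w : P, if v ⋖ w ∧ lam v w < lam u v then J v w else 0 := by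
    intro u v
    by_cases hv : v = ⊤
    · subst hv
      simp [hI, hJ, edgeSum_zero, hntop]
    · obtain ⟨m, hm⟩ : ∃ m, rk ⊤ - rk v = m + 1 := ⟨rk ⊤ - rk v - 1, by have := hlt v hv; omega⟩
      simp only [hJ, hI, hm, edgeSum_succ]
      congr 2
      refine Finset.sum_congr rfl fun w _ => ite_congr rfl (fun hw => ?_) fun _ => rfl
      rw [← hpred v w hw.1, hm, Nat.add_sub_cancel]
  have hhrec : ∀ u, h u = (if u = ⊤ then 1 else 0) + ∑ v : P, if u ⋖ v then I u v else 0 := by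
    intro v
    by_cases hv : v = ⊤
    · subst hv
      simp [hh, vertexSum_zero, hntop]
    · obtain ⟨m, hm⟩ : ∃ m, rk ⊤ - rk v = m + 1 := ⟨rk ⊤ - rk v - 1, by have := hlt v hv; omega⟩
      simp only [hh, hI, hm, vertexSum_succ, hv, if_false, zero_add]
      refine Finset.sum_congr rfl fun w _ => ite_congr rfl (fun hw => ?_) fun _ => rfl
      rw [← hpred v w hw, hm, Nat.add_sub_cancel]
  set D : (P → P → ℤ[X]) → P → P → ℤ[X] := fun Y u v =>
    ∑ w : P, if v ⋖ w ∧ lam v w < lam u v then Y v w else 0 with hD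
  have hDlin : ∀ (Y Z : P → P → ℤ[X]) (c : ℤ[X]) u v,
      D (fun u v => Y u v + c * Z u v) u v = D Y u v + c * D Z u v := by
    intro Y Z c u v
    simp only [hD, Finset.mul_sum, ← Finset.sum_add_distrib]
    exact Finset.sum_congr rfl fun w _ => by split_ifs <;> simp
  have hhJ : ∀ u v, h v = J u v + (X + 1) * D J u v + X * D (D J) u v := by
    intro u v
    have h1 : D I u v = (X + 1) * D J u v + X * D (D J) u v := by
      simp only [hD, Finset.mul_sum, ← Finset.sum_add_distrib]
      refine Finset.sum_congr rfl fun w _ => ?_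
      split_ifs with hw
      · rw [hIrec, Finset.mul_sum]
      · simp
    rw [hhrec, add_assoc, ← h1, hJrec u v, add_assoc]
    simp only [hD]
    rw [← Finset.sum_add_distrib]
    congr 1
    refine Finset.sum_congr rfl fun w _ => ?_
    by_cases hw : v ⋖ w
    · rcases le_or_gt (lam u v) (lam v w) with hl | hl
      · simp [hw, hl, hl.not_gt]
      · simp [hw, hl, hl.not_ge]
    · simp [hw]
  -- the edge functions that invert the zeta functions of weight `X` and of weight `1`
  set Yx : P → P → ℤ[X] := fun u v => J u v + 1 * D J u v with hYx
  set Y1 : P → P → ℤ[X] := fun u v => J u v + X * D J u v with hY1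
  set p : P → ℤ[X] := fun b => h b - X * ∑ v : P, if b ⋖ v then Yx b v else 0 with hp
  set r : P → ℤ[X] := fun b => h b - 1 * ∑ v : P, if b ⋖ v then Y1 b v else 0 with hr
  have hzp := sum_zeta_eq hmono hcov hsnd hlam X h Yx fun u v _ => by
    have := hDlin J (D J) 1 u v
    simp only [hD] at this ⊢
    rw [this, hhJ u v]
    simp only [hYx, hD]
    ring
  have hzr := sum_zeta_eq hmono hcov hsnd hlam 1 h Y1 fun u v _ => by
    have := hDlin J (D J) X u v
    simp only [hD] at this ⊢
    rw [this, hhJ u v]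
    simp only [hY1, hD]
    ring
  have hpr : ∀ a, X * p a = r a + if a = ⊤ then X - 1 else 0 := by
    intro a
    have h1 : ∀ v, (if a ⋖ v then I a v else 0) * (X - 1) =
        X ^ 2 * (if a ⋖ v then Yx a v else 0) - (if a ⋖ v then Y1 a v else 0) := by
      intro v
      split_ifs
      · rw [hIrec]
        simp only [hYx, hY1, hD]
        ring
      · simp
    have h2 : h a * (X - 1) = (if a = ⊤ then X - 1 else 0) +
        (X ^ 2 * (∑ v, if a ⋖ v then Yx a v else 0) - ∑ v, if a ⋖ v then Y1 a v else 0) := by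
      rw [hhrec a, add_mul, Finset.sum_mul, Finset.sum_congr rfl fun v _ => h1 v,
        Finset.sum_sub_distrib, Finset.mul_sum]
      simp
    simp only [hp, hr]
    linear_combination h2
  refine ⟨p, fun a => ?_, ?_⟩
  · have h1 : ∀ b, (if a ≤ b then (X - X ^ (rk b - rk a)) * p b else 0) =
        (if a ≤ b then 1 ^ (rk b - rk a) * r b else 0) + (if b = ⊤ then X - 1 else 0) -
          if a ≤ b then X ^ (rk b - rk a) * p b else 0 := by
      intro b
      by_cases hab : a ≤ b
      · simp only [hab, if_true, sub_mul, hpr b, one_pow, one_mul]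
      · have : b ≠ ⊤ := by rintro rfl; exact hab le_top
        simp [hab, this]
    rw [Finset.sum_congr rfl fun b _ => h1 b, Finset.sum_sub_distrib, Finset.sum_add_distrib,
      hzp a, hzr a]
    simp
  · rw [isolatedDescentSum_eq_vertexSum]
    have := hzp ⊥
    simp only [bot_le, if_true, hbot, Nat.sub_zero, hh] at this
    rw [← this]

end Chow

end ChainPoset

/-! ### Chains weighted by reduced characteristic polynomials -/

namespace ChainPoset

section ChowPolynomial

open Polynomial

variable {P : Type*} [PartialOrder P]

lemma strictMono_cons {k : ℕ} {a : P} {c : Fin (k + 1) → P} :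
    StrictMono (Fin.cons a c : Fin (k + 1 + 1) → P) ↔ a < c 0 ∧ StrictMono c := by
  rw [Fin.strictMono_iff_lt_succ, Fin.strictMono_iff_lt_succ]
  constructor
  · intro h
    refine ⟨by simpa using h 0, fun i => ?_⟩
    have := h i.succ
    rwa [Fin.cons_succ, Fin.castSucc_succ, Fin.cons_succ] at this
  · rintro ⟨h1, h2⟩ i
    refine Fin.cases (by simpa using h1) (fun j => ?_) i
    rw [Fin.cons_succ, Fin.castSucc_succ, Fin.cons_succ]
    exact h2 j

section IntervalCharpoly

variable [LocallyFiniteOrder P] [DecidableEq P]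

open scoped Classical in
lemma sum_mu_mul_ite [Fintype P] (a b : P) (f : P → ℤ[X]) :
    ∑ z : P, C (IncidenceAlgebra.mu ℤ a z) * (if z ≤ b then f z else 0) =
      ∑ z ∈ Finset.Icc a b, C (IncidenceAlgebra.mu ℤ a z) * f z := by
  symm
  refine Finset.sum_subset_zero_on_sdiff (Finset.subset_univ _) (fun z hz => ?_) fun z hz => ?_
  · simp only [Finset.mem_sdiff, Finset.mem_univ, true_and, Finset.mem_Icc, not_and] at hz
    by_cases haz : a ≤ z
    · simp [hz haz]
    · simp [IncidenceAlgebra.apply_eq_zero_of_not_le haz]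
  · simp [(Finset.mem_Icc.1 hz).2]

variable [GradeMinOrder ℕ P]

lemma intervalCharpoly_self (a : P) : intervalCharpoly a a = 1 := by
  simp [intervalCharpoly]

lemma mul_reducedCharpoly {a b : P} (hab : a < b) :
    (X - 1) * reducedCharpoly a b = intervalCharpoly a b := by
  have := (mul_divByMonic_eq_iff_isRoot (p := intervalCharpoly a b) (a := (1 : ℤ))).2 (by
    have h := IncidenceAlgebra.sum_Icc_mu_right (𝕜 := ℤ) a b
    rw [if_neg hab.ne] at h
    simpa [IsRoot, intervalCharpoly, eval_finsetSum] using h)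
  rwa [C_1] at this

end IntervalCharpoly

variable [Fintype P]

open scoped Classical in
/-- The equation of the Chow function, with the term of `p a` isolated and divided by `x - 1`. -/
lemma IsChowFunction.eq_one_add {rk : P → ℕ} (hmono : StrictMono rk) {p : P → ℤ[X]}
    (hp : IsChowFunction rk p) (a : P) :
    p a = 1 + ∑ b : P, if a < b then (∑ j ∈ Finset.Ico 1 (rk b - rk a), X ^ j) * p b else 0 := by
  have h1 : (X - 1 : ℤ[X]) ≠ 0 := by simpa using X_sub_C_ne_zero (1 : ℤ)
  have h := hp a
  have h2 : ∀ b, (if a ≤ b then (X - X ^ (rk b - rk a)) * p b else 0) =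
      (X - 1) * ((if b = a then p a else 0) -
        if a < b then (∑ j ∈ Finset.Ico 1 (rk b - rk a), X ^ j) * p b else 0) := by
    intro b
    rcases eq_or_ne b a with rfl | hb
    · simp
    · by_cases hab : a < b
      · have h3 : 1 ≤ rk b - rk a := by have := hmono hab; omega
        have h4 := geom_sum_Ico_mul (X : ℤ[X]) h3
        simp only [hab, hab.le, hb, if_true, if_false]
        linear_combination (p b) * h4
      · simp [hab, hb, show ¬ a ≤ b from fun h => hab (h.lt_of_ne' hb)]
  rw [Finset.sum_congr rfl fun b _ => h2 b, ← Finset.mul_sum, Finset.sum_sub_distrib] at h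
  have h3 := mul_left_cancel₀ h1 (h.trans (mul_one _).symm)
  simp only [Finset.sum_ite_eq', Finset.mem_univ, if_true] at h3
  linear_combination h3

variable [BoundedOrder P]

lemma IsChowFunction.top_eq_one {rk : P → ℕ} {p : P → ℤ[X]} (hp : IsChowFunction rk p) :
    p ⊤ = 1 := by
  have h := hp ⊤
  rw [Fintype.sum_eq_single ⊤ fun b hb => if_neg fun h => hb (top_le_iff.1 h), if_pos le_rfl,
    Nat.sub_self, pow_zero] at h
  have h1 : (X - 1 : ℤ[X]) ≠ 0 := by simpa using X_sub_C_ne_zero (1 : ℤ)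
  exact mul_left_cancel₀ h1 (by rw [h, mul_one])

variable [LocallyFiniteOrder P] [DecidableEq P] [GradeMinOrder ℕ P]

open scoped Classical in
/-- Möbius inversion of the equation of the Chow function: its values are the Chow polynomials in
the sense of chains weighted by reduced characteristic polynomials. -/
lemma IsChowFunction.eq_sum_reducedCharpoly {p : P → ℤ[X]} (hp : IsChowFunction (grade ℕ) p)
    {a : P} (ha : a ≠ ⊤) :
    p a = ∑ b : P, if a < b then reducedCharpoly a b * p b else 0 := by
  have h1 : (X - 1 : ℤ[X]) ≠ 0 := by simpa using X_sub_C_ne_zero (1 : ℤ)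
  have hconst : ∀ b : P, ∑ z ∈ Finset.Icc a b, C (IncidenceAlgebra.mu ℤ a z) =
      if a = b then 1 else 0 := by
    intro b
    rw [← map_sum, IncidenceAlgebra.sum_Icc_mu_right]
    split_ifs <;> simp
  have hE : ∑ z : P, C (IncidenceAlgebra.mu ℤ a z) *
      ∑ b : P, (if z ≤ b then (X - X ^ (grade ℕ b - grade ℕ z)) * p b else 0) = 0 := by
    simp_rw [hp _]
    rw [← Finset.sum_mul]
    have := sum_mu_mul_ite a ⊤ (fun _ => 1)
    simp only [le_top, if_true, mul_one] at this
    rw [this, hconst, if_neg ha, zero_mul]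
  simp_rw [Finset.mul_sum] at hE
  rw [Finset.sum_comm] at hE
  have h2 : ∀ b : P, ∑ z : P, C (IncidenceAlgebra.mu ℤ a z) *
      (if z ≤ b then (X - X ^ (grade ℕ b - grade ℕ z)) * p b else 0) =
      (X - 1) * ((if b = a then p a else 0) - if a < b then reducedCharpoly a b * p b else 0) := by
    intro b
    rw [sum_mu_mul_ite]
    have h3 : ∑ z ∈ Finset.Icc a b, C (IncidenceAlgebra.mu ℤ a z) *
        ((X - X ^ (grade ℕ b - grade ℕ z)) * p b) =
        (X * (if a = b then 1 else 0) - intervalCharpoly a b) * p b := by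
      rw [← hconst, intervalCharpoly, Finset.mul_sum, ← Finset.sum_sub_distrib, Finset.sum_mul]
      exact Finset.sum_congr rfl fun z _ => by ring
    rw [h3]
    rcases eq_or_ne b a with rfl | hb
    · simp [intervalCharpoly_self]
    · by_cases hab : a < b
      · rw [← mul_reducedCharpoly hab]
        simp only [hab, hb, hb.symm, if_true, if_false]
        ring
      · have : ¬ a ≤ b := fun h => hab (h.lt_of_ne' hb)
        simp [hab, hb, hb.symm, intervalCharpoly, Finset.Icc_eq_empty this]
  rw [Finset.sum_congr rfl fun b _ => h2 b, ← Finset.mul_sum, Finset.sum_sub_distrib] at hE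
  have h3 := (mul_eq_zero.1 hE).resolve_left h1
  simp only [Finset.sum_ite_eq', Finset.mem_univ, if_true] at h3
  linear_combination h3

open scoped Classical in
/-- The sum of the products of the reduced characteristic polynomials over the chains of length
`k` from `a` to `⊤`. -/
noncomputable def charpolyChainSum (k : ℕ) (a : P) : ℤ[X] :=
  ∑ c : Fin (k + 1) → P, if StrictMono c ∧ c (Fin.last k) = ⊤ ∧ c 0 = a then
    ∏ i : Fin k, reducedCharpoly (c i.castSucc) (c i.succ) else 0

open scoped Classical in
lemma charpolyChainSum_zero (a : P) : charpolyChainSum 0 a = if a = ⊤ then 1 else 0 := by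
  rw [charpolyChainSum, Fintype.sum_eq_single fun _ => a]
  · refine ite_congr ?_ (fun _ => by simp) fun _ => rfl
    simp [Subsingleton.strictMono]
  · intro c hc
    refine if_neg fun h => hc ?_
    ext i
    rw [Subsingleton.elim (α := Fin 1) i 0, h.2.2]

open scoped Classical in
lemma charpolyChainSum_succ (k : ℕ) (a : P) :
    charpolyChainSum (k + 1) a =
      ∑ b : P, if a < b then reducedCharpoly a b * charpolyChainSum k b else 0 := by
  rw [charpolyChainSum, sum_fin_cons, Fintype.sum_eq_single a]
  · have : ∀ b : P, (if a < b then reducedCharpoly a b * charpolyChainSum k b else 0) =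
        ∑ c : Fin (k + 1) → P, if a < b ∧ StrictMono c ∧ c (Fin.last k) = ⊤ ∧ c 0 = b then
          reducedCharpoly a b * ∏ i : Fin k, reducedCharpoly (c i.castSucc) (c i.succ) else 0 := by
      intro b
      rw [charpolyChainSum, Finset.mul_sum]
      split_ifs with h <;> simp [h]
    rw [Finset.sum_congr rfl fun b _ => this b, Finset.sum_comm]
    refine Finset.sum_congr rfl fun c _ => ?_
    rw [Fintype.sum_eq_single (c 0)]
    · refine ite_congr ?_ (fun _ => ?_) fun _ => rfl
      · rw [strictMono_cons, ← Fin.succ_last, Fin.cons_succ]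
        simp [and_assoc]
      · rw [Fin.prod_univ_succ]
        congr 1
    · exact fun w hw => if_neg fun h => hw h.2.2.2.symm
  · intro u hu
    exact Finset.sum_eq_zero fun c _ => if_neg fun h => hu h.2.2

lemma charpolyChainSum_eq_zero (k : ℕ) (a : P) (h : grade ℕ (⊤ : P) < k + grade ℕ a) :
    charpolyChainSum k a = 0 := by
  classical
  induction k generalizing a with
  | zero =>
    rw [charpolyChainSum_zero, if_neg]
    rintro rfl
    omega
  | succ k ih =>
    rw [charpolyChainSum_succ]
    refine Finset.sum_eq_zero fun b _ => ?_
    split_ifs with hab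
    · have : grade ℕ a < grade ℕ b := grade_strictMono hab
      rw [ih b (by omega), mul_zero]
    · rfl

lemma IsChowFunction.eq_sum_charpolyChainSum {p : P → ℤ[X]} (hp : IsChowFunction (grade ℕ) p)
    (a : P) : p a = ∑ k ∈ Finset.range (grade ℕ (⊤ : P) + 1), charpolyChainSum k a := by
  classical
  induction a using (wellFounded_gt (α := P)).induction with
  | _ a ih =>
    rw [Finset.sum_range_succ', charpolyChainSum_zero]
    simp_rw [charpolyChainSum_succ]
    rw [Finset.sum_comm]
    by_cases ha : a = ⊤
    · subst ha
      simp [hp.top_eq_one]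
    · rw [hp.eq_sum_reducedCharpoly ha, if_neg ha, add_zero]
      refine Finset.sum_congr rfl fun b _ => ?_
      split_ifs with hab
      · rw [ih b hab, Finset.sum_range_succ, charpolyChainSum_eq_zero, add_zero, Finset.mul_sum]
        have : grade ℕ a < grade ℕ b := grade_strictMono hab
        omega
      · simp

lemma IsChowFunction.augmentedChowPolynomial_eq {p : P → ℤ[X]}
    (hp : IsChowFunction (grade ℕ) p) :
    augmentedChowPolynomial P = ∑ b : P, X ^ grade ℕ b * p b := by
  classical
  simp_rw [hp.eq_sum_charpolyChainSum, Finset.mul_sum]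
  rw [Finset.sum_comm, augmentedChowPolynomial]
  refine Finset.sum_congr rfl fun k _ => ?_
  simp_rw [charpolyChainSum, Finset.mul_sum]
  rw [Finset.sum_comm, Finset.sum_filter]
  refine Finset.sum_congr rfl fun c _ => ?_
  rw [Fintype.sum_eq_single (c 0)]
  · rw [mul_ite, mul_zero]
    exact ite_congr (by simp) (fun _ => rfl) fun _ => rfl
  · exact fun b hb => by rw [if_neg fun h => hb h.2.2.symm, mul_zero]

end ChowPolynomial

end ChainPoset

/-! ### Standard monomials -/

namespace ChainPoset

section StandardMonomials

open Polynomial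

variable {L : Type*}

lemma support_single_add {b : L} {j : ℕ} (hj : j ≠ 0) {m : L →₀ ℕ} {G : L} :
    G ∈ (Finsupp.single b j + m).support ↔ G = b ∨ G ∈ m.support := by
  classical
  simp only [Finsupp.mem_support_iff, Finsupp.add_apply, Finsupp.single_apply]
  split_ifs with h <;> simp [h, eq_comm]; omega

lemma single_add_apply_of_ne {b G : L} (h : G ≠ b) (j : ℕ) (m : L →₀ ℕ) :
    (Finsupp.single b j + m) G = m G := by
  simp [h.symm]

variable [PartialOrder L]

/-- The exponent vector `m` is supported on a chain of elements above `a`, and the exponent of each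
`G` in the support is less than `rk G - rk a + s` and less than `rk G - rk F` for all smaller `F` in
the support. -/
structure IsStandardAbove (rk : L → ℕ) (a : L) (s : ℕ) (m : L →₀ ℕ) : Prop where
  chain : ∀ F ∈ m.support, ∀ G ∈ m.support, F ≤ G ∨ G ≤ F
  lt : ∀ G ∈ m.support, a < G
  add_lt : ∀ G ∈ m.support, m G + rk a < rk G + s
  gap : ∀ F ∈ m.support, ∀ G ∈ m.support, F < G → m G + rk F < rk G

/-- The standard exponent vectors, those of the standard monomials in the augmented Chow ring: `m`
is supported on a chain, the exponent of `G` is at most `rk G`, and less than `rk G - rk F` if `F`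
is in the support and smaller than `G`. -/
structure IsStandard (rk : L → ℕ) (m : L →₀ ℕ) : Prop where
  chain : ∀ F ∈ m.support, ∀ G ∈ m.support, F ≤ G ∨ G ≤ F
  le : ∀ G, m G ≤ rk G
  gap : ∀ F ∈ m.support, ∀ G ∈ m.support, F < G → m G + rk F < rk G

lemma isStandardAbove_bot_one_iff [OrderBot L] {rk : L → ℕ} (hbot : rk ⊥ = 0) {m : L →₀ ℕ} :
    IsStandardAbove rk ⊥ 1 m ↔ IsStandard rk m := by
  constructor
  · rintro ⟨h1, -, h3, h4⟩
    refine ⟨h1, fun G => ?_, h4⟩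
    by_cases hG : G ∈ m.support
    · have := h3 G hG; omega
    · simp [Finsupp.notMem_support_iff.1 hG]
  · rintro ⟨h1, h2, h3⟩
    refine ⟨h1, fun G hG => bot_lt_iff_ne_bot.2 ?_, fun G _ => ?_, h3⟩
    · rintro rfl
      have := h2 ⊥
      exact Finsupp.mem_support_iff.1 hG (by omega)
    · have := h2 G; omega

lemma IsStandardAbove.le {rk : L → ℕ} {a : L} {m : L →₀ ℕ} {s : ℕ} (h : IsStandardAbove rk a s m)
    (G : L) : m G ≤ rk G + s := by
  by_cases hG : G ∈ m.support
  · have := h.add_lt G hG; omega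
  · simp [Finsupp.notMem_support_iff.1 hG]

variable [Fintype L]

open scoped Classical in
/-- The finite set of the exponent vectors `m` with `IsStandardAbove rk a s m`. -/
noncomputable def standardAbove (rk : L → ℕ) (a : L) (s : ℕ) : Finset (L →₀ ℕ) :=
  {m ∈ Finset.Iic (Finsupp.equivFunOnFinite.symm fun G => rk G + s) | IsStandardAbove rk a s m}

lemma mem_standardAbove {rk : L → ℕ} {a : L} {s : ℕ} {m : L →₀ ℕ} :
    m ∈ standardAbove rk a s ↔ IsStandardAbove rk a s m := by
  simp only [standardAbove, Finset.mem_filter, Finset.mem_Iic, and_iff_right_iff_imp]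
  exact fun h G => h.le G

/-- A nonconstant standard monomial is a power of its least variable times a standard monomial in
the variables above it. -/
lemma sum_standardAbove (rk : L → ℕ) (a : L) (s : ℕ) [DecidableLT L] :
    ∑ m ∈ standardAbove rk a s, (X : ℤ[X]) ^ m.degree =
      1 + ∑ b : L, if a < b then (∑ j ∈ Finset.Ico 1 (rk b + s - rk a), X ^ j) *
        ∑ m ∈ standardAbove rk b 0, X ^ m.degree else 0 := by
  classical
  have h0 : (0 : L →₀ ℕ) ∈ standardAbove rk a s := by
    rw [mem_standardAbove]
    constructor <;> simp
  rw [← Finset.add_sum_erase _ _ h0, map_zero, pow_zero, ← Finset.sum_filter]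
  congr 1
  simp_rw [Finset.sum_mul_sum, ← Finset.sum_product', Finset.sum_sigma']
  symm
  refine Finset.sum_bij (fun x _ => Finsupp.single x.1 x.2.1 + x.2.2) ?_ ?_ ?_ ?_
  · rintro ⟨b, j, m⟩ hx
    simp only [Finset.mem_sigma, Finset.mem_filter, Finset.mem_univ, true_and, Finset.mem_product,
      Finset.mem_Ico, mem_standardAbove] at hx
    obtain ⟨hab, ⟨hj1, hj2⟩, hm⟩ := hx
    have hj : j ≠ 0 := by omega
    have hmb : m b = 0 := by
      by_contra h
      exact lt_irrefl _ (hm.lt b (Finsupp.mem_support_iff.2 h))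
    rw [Finset.mem_erase, mem_standardAbove]
    refine ⟨fun h => hj ?_, ⟨?_, ?_, ?_, ?_⟩⟩
    · have := DFunLike.congr_fun h b
      simp only [Finsupp.add_apply, Finsupp.single_eq_same, Finsupp.coe_zero, Pi.zero_apply] at this
      omega
    · intro F hF G hG
      rcases (support_single_add hj).1 hF with rfl | hF' <;>
        rcases (support_single_add hj).1 hG with rfl | hG'
      · exact Or.inl le_rfl
      · exact Or.inl (hm.lt G hG').le
      · exact Or.inr (hm.lt F hF').le
      · exact hm.chain F hF' G hG'
    · intro G hG
      rcases (support_single_add hj).1 hG with rfl | hG'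
      · exact hab
      · exact hab.trans (hm.lt G hG')
    · intro G hG
      rcases (support_single_add hj).1 hG with rfl | hG'
      · simp only [Finsupp.add_apply, Finsupp.single_eq_same]
        omega
      · dsimp only
        rw [single_add_apply_of_ne (hm.lt G hG').ne']
        have := hm.add_lt G hG'
        omega
    · intro F hF G hG hFG
      rcases (support_single_add hj).1 hG with rfl | hG'
      · rcases (support_single_add hj).1 hF with rfl | hF'
        · exact absurd hFG (lt_irrefl _)
        · exact absurd hFG (hm.lt F hF').not_gt
      · rw [single_add_apply_of_ne (hm.lt G hG').ne']
        rcases (support_single_add hj).1 hF with rfl | hF'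
        · have := hm.add_lt G hG'
          omega
        · exact hm.gap F hF' G hG' hFG
  · rintro ⟨b, j, m⟩ hx ⟨b', j', m'⟩ hx' heq
    simp only [Finset.mem_sigma, Finset.mem_filter, Finset.mem_univ, true_and, Finset.mem_product,
      Finset.mem_Ico, mem_standardAbove] at hx hx' heq
    obtain ⟨hab, ⟨hj1, hj2⟩, hm⟩ := hx
    obtain ⟨hab', ⟨hj1', hj2'⟩, hm'⟩ := hx'
    have hle : b' ≤ b := by
      have := (support_single_add (by omega : j ≠ 0) (b := b) (m := m)).2 (Or.inl rfl)
      rw [heq, support_single_add (by omega)] at this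
      exact this.elim (fun h => h.ge) fun h => (hm'.lt b h).le
    have hle' : b ≤ b' := by
      have := (support_single_add (by omega : j' ≠ 0) (b := b') (m := m')).2 (Or.inl rfl)
      rw [← heq, support_single_add (by omega)] at this
      exact this.elim (fun h => h.ge) fun h => (hm.lt b' h).le
    obtain rfl : b = b' := le_antisymm hle' hle
    have hmb : m b = 0 := by
      by_contra h
      exact lt_irrefl _ (hm.lt b (Finsupp.mem_support_iff.2 h))
    have hmb' : m' b = 0 := by
      by_contra h
      exact lt_irrefl _ (hm'.lt b (Finsupp.mem_support_iff.2 h))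
    have hjj := DFunLike.congr_fun heq b
    simp only [Finsupp.add_apply, Finsupp.single_eq_same, hmb, hmb', add_zero] at hjj
    subst hjj
    rw [add_left_cancel heq]
  · intro m hm
    rw [Finset.mem_erase, mem_standardAbove] at hm
    obtain ⟨hm0, hm⟩ := hm
    obtain ⟨b, hb⟩ := Finset.exists_minimal (Finsupp.support_nonempty_iff.2 hm0)
    have hbm : b ∈ m.support := hb.prop
    have hlt : ∀ G ∈ m.support, G ≠ b → b < G := fun G hG hGb => by
      rcases hm.chain b hbm G hG with h | h
      · exact lt_of_le_of_ne h hGb.symm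
      · exact absurd (hb.eq_of_le hG h) hGb
    have hsub : ∀ G ∈ (m.erase b).support, G ∈ m.support ∧ G ≠ b := fun G hG => by
      rw [Finsupp.support_erase, Finset.mem_erase] at hG
      exact ⟨hG.2, hG.1⟩
    refine ⟨⟨b, m b, m.erase b⟩, ?_, Finsupp.single_add_erase b m⟩
    simp only [Finset.mem_sigma, Finset.mem_filter, Finset.mem_univ, true_and, Finset.mem_product,
      Finset.mem_Ico, mem_standardAbove]
    have h1 := hm.add_lt b hbm
    have h2 := Finsupp.mem_support_iff.1 hbm
    refine ⟨hm.lt b hbm, ⟨by omega, by omega⟩, ⟨?_, ?_, ?_, ?_⟩⟩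
    · exact fun F hF G hG => hm.chain F (hsub F hF).1 G (hsub G hG).1
    · exact fun G hG => hlt G (hsub G hG).1 (hsub G hG).2
    · intro G hG
      rw [Finsupp.erase_ne (hsub G hG).2]
      exact hm.gap b hbm G (hsub G hG).1 (hlt G (hsub G hG).1 (hsub G hG).2)
    · intro F hF G hG hFG
      rw [Finsupp.erase_ne (hsub G hG).2]
      exact hm.gap F (hsub F hF).1 G (hsub G hG).1 hFG
  · rintro ⟨b, j, m⟩ -
    simp [Finsupp.degree_single, pow_add]

lemma IsChowFunction.eq_sum_standardAbove {rk : L → ℕ} (hmono : StrictMono rk) {p : L → ℤ[X]}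
    (hp : IsChowFunction rk p) (a : L) :
    p a = ∑ m ∈ standardAbove rk a 0, X ^ m.degree := by
  classical
  induction a using (wellFounded_gt (α := L)).induction with
  | _ a ih =>
    refine (hp.eq_one_add hmono a).trans (Eq.trans ?_ (sum_standardAbove rk a 0).symm)
    refine congrArg (1 + ·) ?_
    refine Finset.sum_congr rfl fun b _ => ?_
    split_ifs with hb
    · rw [ih b hb, Nat.add_zero]
    · rfl

/-- The Chow function, weighted by `x ^ rk`, enumerates the standard monomials by degree. -/
lemma IsChowFunction.sum_pow_mul_eq [OrderBot L] {rk : L → ℕ} (hmono : StrictMono rk)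
    (hbot : rk ⊥ = 0) {p : L → ℤ[X]} (hp : IsChowFunction rk p) :
    ∑ b : L, X ^ rk b * p b = ∑ m ∈ standardAbove rk ⊥ 1, X ^ m.degree := by
  classical
  rw [sum_standardAbove]
  simp_rw [← hp.eq_sum_standardAbove hmono]
  have h : ∀ b : L, X ^ rk b * p b + (if ⊥ < b then
      (∑ j ∈ Finset.Ico 1 (rk b - rk ⊥), X ^ j) * p b else 0) = (if b = ⊥ then p ⊥ else 0) +
      if ⊥ < b then (∑ j ∈ Finset.Ico 1 (rk b + 1 - rk ⊥), X ^ j) * p b else 0 := by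
    intro b
    rcases eq_or_ne b ⊥ with rfl | hb
    · simp [hbot]
    · have hb' := bot_lt_iff_ne_bot.2 hb
      have := hmono hb'
      simp only [hb', hb, if_true, if_false, hbot, Nat.sub_zero]
      rw [Finset.sum_Ico_succ_top (by omega)]
      ring
  have h2 := Finset.sum_congr rfl fun b (_ : b ∈ Finset.univ) => h b
  rw [Finset.sum_add_distrib, Finset.sum_add_distrib] at h2
  have h3 := hp.eq_one_add hmono ⊥
  simp only [Finset.sum_ite_eq', Finset.mem_univ, if_true] at h2
  linear_combination h2 + h3

end StandardMonomials

end ChainPoset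

/-! ### The Hall–Rado condition in a lattice with submodular rank -/

namespace ChainPoset

section HallRado

variable {L : Type*}

lemma degree_sup_add_degree_inf (u v : L →₀ ℕ) :
    (u ⊔ v).degree + (u ⊓ v).degree = u.degree + v.degree := by
  rw [← map_add, ← map_add]
  congr 1
  ext G
  simp only [Finsupp.add_apply, Finsupp.sup_apply, Finsupp.inf_apply]
  omega

lemma le_add_single_cases {u m : L →₀ ℕ} {H : L} (h : u ≤ m + Finsupp.single H 1) :
    u ≤ m ∨ ∃ v ≤ m, u = v + Finsupp.single H 1 := by
  classical
  by_cases hu : u H ≤ m H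
  · refine Or.inl fun G => ?_
    have := h G
    rw [Finsupp.add_apply, Finsupp.single_apply] at this
    split_ifs at this with hG
    · exact hG ▸ hu
    · exact this
  · refine Or.inr ⟨u - Finsupp.single H 1, fun G => ?_, ?_⟩
    · have := h G
      rw [Finsupp.add_apply] at this
      rw [Finsupp.tsub_apply]
      omega
    · ext G
      rw [Finsupp.add_apply, Finsupp.tsub_apply, Finsupp.single_apply]
      split_ifs with hG
      · subst hG; omega
      · omega

variable [Lattice L] [OrderBot L]

/-- The join of the support of an exponent vector. -/
def supportSup (m : L →₀ ℕ) : L := m.support.sup id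

/-- The Hall–Rado condition for the multiset of lattice elements `m`: every submultiset `u` has at
most `rk (⋁ u)` members. For the flats of a matroid this says that `m` has an independent
transversal. -/
def HallRado (rk : L → ℕ) (m : L →₀ ℕ) : Prop := ∀ u ≤ m, u.degree ≤ rk (supportSup u)

/-- `H` violates the Hall–Rado condition relative to `m`: if `m` satisfies the Hall–Rado condition,
then adding `H` to `m` destroys it. -/
def IsDeficient (rk : L → ℕ) (m : L →₀ ℕ) (H : L) : Prop :=
  ∃ u ≤ m, rk (H ⊔ supportSup u) ≤ u.degree

lemma le_supportSup {m : L →₀ ℕ} {G : L} (h : m G ≠ 0) : G ≤ supportSup m :=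
  Finset.le_sup (f := id) (Finsupp.mem_support_iff.2 h)

lemma supportSup_le {m : L →₀ ℕ} {F : L} : supportSup m ≤ F ↔ ∀ G, m G ≠ 0 → G ≤ F := by
  simp [supportSup, Finset.sup_le_iff]

lemma supportSup_mono {u v : L →₀ ℕ} (h : u ≤ v) : supportSup u ≤ supportSup v :=
  supportSup_le.2 fun G hG => le_supportSup fun h0 => hG (by have := h G; omega)

@[simp] lemma supportSup_zero : supportSup (0 : L →₀ ℕ) = ⊥ := by simp [supportSup]

lemma supportSup_sup (u v : L →₀ ℕ) : supportSup (u ⊔ v) = supportSup u ⊔ supportSup v := by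
  refine le_antisymm (supportSup_le.2 fun G hG => ?_)
    (sup_le (supportSup_mono le_sup_left) (supportSup_mono le_sup_right))
  rw [Finsupp.sup_apply] at hG
  by_cases h : u G = 0
  · exact le_sup_of_le_right (le_supportSup (by omega))
  · exact le_sup_of_le_left (le_supportSup h)

lemma supportSup_add_single (u : L →₀ ℕ) (H : L) :
    supportSup (u + Finsupp.single H 1) = H ⊔ supportSup u := by
  classical
  refine le_antisymm (supportSup_le.2 fun G hG => ?_) (sup_le (le_supportSup (by simp))
    (supportSup_mono (by simp)))
  rw [Finsupp.add_apply, Finsupp.single_apply] at hG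
  split_ifs at hG with h
  · exact h ▸ le_sup_left
  · exact le_sup_of_le_right (le_supportSup (by omega))

variable {rk : L → ℕ}

lemma HallRado.mono {u v : L →₀ ℕ} (hv : HallRado rk v) (h : u ≤ v) : HallRado rk u :=
  fun w hw => hv w (hw.trans h)

lemma hallRado_add_single {m : L →₀ ℕ} {H : L} :
    HallRado rk (m + Finsupp.single H 1) ↔ HallRado rk m ∧ ¬ IsDeficient rk m H := by
  constructor
  · refine fun h => ⟨h.mono (by simp), ?_⟩
    rintro ⟨u, hu, hdeg⟩
    have := h (u + Finsupp.single H 1) (add_le_add_left hu _)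
    rw [supportSup_add_single, map_add, Finsupp.degree_single] at this
    omega
  · rintro ⟨h1, h2⟩ u hu
    rcases le_add_single_cases hu with hu | ⟨v, hv, rfl⟩
    · exact h1 u hu
    · rw [supportSup_add_single, map_add, Finsupp.degree_single]
      by_contra hlt
      exact h2 ⟨v, hv, by omega⟩

lemma isDeficient_add_single {m : L →₀ ℕ} {F G : L} :
    IsDeficient rk (m + Finsupp.single F 1) G ↔
      IsDeficient rk m G ∨ ∃ u ≤ m, rk (F ⊔ G ⊔ supportSup u) ≤ u.degree + 1 := by
  constructor
  · rintro ⟨u, hu, hdeg⟩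
    rcases le_add_single_cases hu with hu | ⟨v, hv, rfl⟩
    · exact Or.inl ⟨u, hu, hdeg⟩
    · rw [supportSup_add_single, map_add, Finsupp.degree_single, ← sup_assoc, sup_comm G F] at hdeg
      exact Or.inr ⟨v, hv, hdeg⟩
  · rintro (⟨u, hu, hdeg⟩ | ⟨u, hu, hdeg⟩)
    · exact ⟨u, hu.trans (by simp), hdeg⟩
    · refine ⟨u + Finsupp.single F 1, add_le_add_left hu _, ?_⟩
      rwa [supportSup_add_single, map_add, Finsupp.degree_single, ← sup_assoc, sup_comm G F]

lemma hallRado_add_single_add_single {m : L →₀ ℕ} {F G : L} :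
    HallRado rk (m + Finsupp.single F 1 + Finsupp.single G 1) ↔
      HallRado rk m ∧ ¬ IsDeficient rk m F ∧ ¬ IsDeficient rk m G ∧
        ¬ ∃ u ≤ m, rk (F ⊔ G ⊔ supportSup u) ≤ u.degree + 1 := by
  rw [hallRado_add_single, hallRado_add_single, isDeficient_add_single, not_or, and_assoc]

lemma IsDeficient.anti (hmono : StrictMono rk) {m : L →₀ ℕ} {F G : L} (h : IsDeficient rk m G)
    (hFG : F ≤ G) : IsDeficient rk m F := by
  obtain ⟨u, hu, hdeg⟩ := h
  exact ⟨u, hu, (hmono.monotone (sup_le_sup_right hFG _)).trans hdeg⟩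

lemma isDeficient_bot (hbot : rk ⊥ = 0) (m : L →₀ ℕ) : IsDeficient rk m ⊥ :=
  ⟨0, by simp, by simp [hbot]⟩

/-- By submodularity of the rank, the deficient elements are closed under joins. -/
lemma IsDeficient.sup (hmono : StrictMono rk)
    (hsub : ∀ a b, rk (a ⊔ b) + rk (a ⊓ b) ≤ rk a + rk b) {m : L →₀ ℕ} (hm : HallRado rk m)
    {F G : L} (hF : IsDeficient rk m F) (hG : IsDeficient rk m G) : IsDeficient rk m (F ⊔ G) := by
  obtain ⟨u, hu, hu'⟩ := hF
  obtain ⟨v, hv, hv'⟩ := hG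
  refine ⟨u ⊔ v, sup_le hu hv, ?_⟩
  have h1 := hsub (F ⊔ supportSup u) (G ⊔ supportSup v)
  have h2 := hm (u ⊓ v) (inf_le_left.trans hu)
  have h3 : rk (supportSup (u ⊓ v)) ≤ rk ((F ⊔ supportSup u) ⊓ (G ⊔ supportSup v)) :=
    hmono.monotone (le_inf ((supportSup_mono inf_le_left).trans le_sup_right)
      ((supportSup_mono inf_le_right).trans le_sup_right))
  rw [sup_sup_sup_comm, ← supportSup_sup] at h1
  have h4 := degree_sup_add_degree_inf u v
  omega

/-- The deficient elements form a principal ideal. For the flats of a matroid its generator is the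
flat of loops of the truncation by the flats in `m`. -/
lemma exists_isDeficient_iff_le [Fintype L] (hmono : StrictMono rk) (hbot : rk ⊥ = 0)
    (hsub : ∀ a b, rk (a ⊔ b) + rk (a ⊓ b) ≤ rk a + rk b) {m : L →₀ ℕ} (hm : HallRado rk m) :
    ∃ Z, ∀ H, IsDeficient rk m H ↔ H ≤ Z := by
  classical
  refine ⟨({H | IsDeficient rk m H} : Finset L).sup id, fun H => ⟨fun h => ?_, fun h => ?_⟩⟩
  · exact Finset.le_sup (f := id) (by simpa using h)
  · refine IsDeficient.anti hmono ?_ h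
    exact Finset.sup_induction (isDeficient_bot hbot m) (fun _ h1 _ h2 => h1.sup hmono hsub hm h2)
      fun b hb => by simpa using hb

section Relations

lemma not_hallRado_add_single_bot (hbot : rk ⊥ = 0) (w : L →₀ ℕ) :
    ¬ HallRado rk (w + Finsupp.single ⊥ 1) := fun h =>
  (hallRado_add_single.1 h).2 (isDeficient_bot hbot w)

open scoped Classical in
/-- The indicator function of the Hall–Rado condition, as a linear functional, kills the multiples
of `(h F - h (F ⊔ G)) * (h G - h (F ⊔ G))`. -/
lemma hallRado_straightening (hmono : StrictMono rk)
    (hsub : ∀ a b, rk (a ⊔ b) + rk (a ⊓ b) ≤ rk a + rk b) (w : L →₀ ℕ) (F G : L) :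
    ((if HallRado rk (w + Finsupp.single F 1 + Finsupp.single G 1) then 1 else 0 : ℚ) -
      (if HallRado rk (w + Finsupp.single F 1 + Finsupp.single (F ⊔ G) 1) then 1 else 0)) -
      (if HallRado rk (w + Finsupp.single G 1 + Finsupp.single (F ⊔ G) 1) then 1 else 0) +
      (if HallRado rk (w + Finsupp.single (F ⊔ G) 1 + Finsupp.single (F ⊔ G) 1) then 1 else 0) =
      0 := by
  simp only [hallRado_add_single_add_single, ← sup_assoc, sup_idem, sup_comm G F]
  rw [sup_assoc F G G, sup_idem]
  by_cases h1 : HallRado rk w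
  · by_cases h2 : ∃ u ≤ w, rk (F ⊔ G ⊔ supportSup u) ≤ u.degree + 1
    · simp [h2]
    · have h3 : ¬ IsDeficient rk w (F ⊔ G) := fun ⟨u, hu, h⟩ => h2 ⟨u, hu, h.trans (by omega)⟩
      have h4 : ¬ (IsDeficient rk w F ∧ IsDeficient rk w G) :=
        fun h => h3 (h.1.sup hmono hsub h1 h.2)
      by_cases hF : IsDeficient rk w F <;> by_cases hG : IsDeficient rk w G <;>
        simp_all
  · simp [h1]

/-- If `a` is an atom, the Hall–Rado condition does not distinguish `{a, F}` from `{a, F ⊔ a}`. -/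
lemma hallRado_atom_iff {a : L} (ha : ∀ x, rk (x ⊔ a) ≤ rk x + 1)
    (w : L →₀ ℕ) (F : L) :
    HallRado rk (w + Finsupp.single a 1 + Finsupp.single F 1) ↔
      HallRado rk (w + Finsupp.single a 1 + Finsupp.single (F ⊔ a) 1) := by
  simp only [hallRado_add_single_add_single]
  rw [sup_comm F a, ← sup_assoc, sup_idem]
  have h1 : (¬ ∃ u ≤ w, rk (a ⊔ F ⊔ supportSup u) ≤ u.degree + 1) → ¬ IsDeficient rk w F := by
    rintro h ⟨u, hu, hdeg⟩
    refine h ⟨u, hu, ?_⟩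
    rw [sup_assoc, sup_comm a]
    exact (ha _).trans (by omega)
  have h2 : (¬ ∃ u ≤ w, rk (a ⊔ F ⊔ supportSup u) ≤ u.degree + 1) →
      ¬ IsDeficient rk w (a ⊔ F) := fun h ⟨u, hu, hdeg⟩ => h ⟨u, hu, by omega⟩
  exact and_congr_right fun _ => and_congr_right fun _ =>
    ⟨fun h => ⟨h2 h.2, h.2⟩, fun h => ⟨h1 h.2, h.2⟩⟩

end Relations

end HallRado
end ChainPoset

/-! ### Linear independence of the Hall–Rado indicator functions -/

namespace ChainPoset

section Independence

lemma degree_erase {L : Type*} (F : L) (m : L →₀ ℕ) : (m.erase F).degree + m F = m.degree := by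
  conv_rhs => rw [← Finsupp.single_add_erase F m, map_add, Finsupp.degree_single]
  omega

lemma le_of_le_add_single {L : Type*} {u v : L →₀ ℕ} {F : L} {k : ℕ}
    (h : u ≤ v + Finsupp.single F k) (hF : u F = 0) : u ≤ v := by
  intro G
  by_cases hG : G = F
  · subst hG; omega
  · have := h G
    rwa [Finsupp.add_apply, Finsupp.single_eq_of_ne hG, add_zero] at this

lemma eq_of_le_of_degree_le {L : Type*} {u v : L →₀ ℕ} (h : u ≤ v) (hd : v.degree ≤ u.degree) :
    u = v := by
  have h1 := congrArg Finsupp.degree (tsub_add_cancel_of_le h)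
  rw [map_add] at h1
  have h2 : (v - u).degree = 0 := by omega
  rw [Finsupp.degree_eq_zero_iff] at h2
  rw [← tsub_add_cancel_of_le h, h2, zero_add]

/-- If the sums of `c` over `{i | H ≤ Z i}` vanish for all `H`, so do the sums over the fibres
of `Z`. -/
lemma sum_fiber_eq_zero {L ι : Type*} [PartialOrder L] [Finite L] (S : Finset ι) (Z : ι → L)
    (c : ι → ℚ) [DecidableLE L] [DecidableEq L] (h : ∀ H, ∑ i ∈ S with H ≤ Z i, c i = 0) (G : L) :
    ∑ i ∈ S with Z i = G, c i = 0 := by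
  have := Fintype.ofFinite L
  induction G using (wellFounded_gt (α := L)).induction with
  | _ G ih =>
    have h1 := h G
    have h2 : ∑ i ∈ S with G ≤ Z i, c i =
        ∑ H : L, if G ≤ H then ∑ i ∈ S with Z i = H, c i else 0 := by
      simp_rw [Finset.sum_filter]
      have : ∀ H : L, (if G ≤ H then ∑ i ∈ S, (if Z i = H then c i else 0) else 0) =
          ∑ i ∈ S, if Z i = H then (if G ≤ H then c i else 0) else 0 := by
        intro H
        split_ifs <;> simp
      simp_rw [this]
      rw [Finset.sum_comm]
      exact Finset.sum_congr rfl fun i _ => by simp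
    rw [h2, Fintype.sum_eq_single G, if_pos le_rfl] at h1
    · exact h1
    · intro H hH
      split_ifs with hGH
      · exact ih H (lt_of_le_of_ne hGH hH.symm)
      · rfl

variable {L : Type*} [Lattice L] [OrderBot L] {rk : L → ℕ}

/-- Let `m` have at least `a` copies of `F`, and pad it by a multiset `w₀` below `G < F` and by
copies of `F` to the degree `rk F - 1`. The elements deficient for the result are those below `G`
exactly if `m` consists of `a` copies of `F` and of elements below `G`. -/
lemma isDeficient_iff_le_iff (hmono : StrictMono rk)
    (hsub : ∀ a b, rk (a ⊔ b) + rk (a ⊓ b) ≤ rk a + rk b) {F G : L} (hGF : G < F) {a e d : ℕ}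
    (he : a + e + 1 + rk G = rk F) {m w₀ : L →₀ ℕ} (hd : m.degree = a + d) (ha : a ≤ m F)
    (hw : ∀ H, w₀ H ≠ 0 → H ≤ G) (hw₀ : w₀.degree + d = rk G) :
    (HallRado rk (m + (w₀ + Finsupp.single F e)) ∧
      ∀ H, IsDeficient rk (m + (w₀ + Finsupp.single F e)) H ↔ H ≤ G) ↔
    m F = a ∧ (∀ H, m.erase F H ≠ 0 → H ≤ G) ∧ HallRado rk (m.erase F + w₀) := by
  have hdeg := degree_erase F m
  have hsplit : m + (w₀ + Finsupp.single F e) =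
      (m.erase F + w₀) + Finsupp.single F (m F + e) := by
    conv_lhs => rw [← Finsupp.single_add_erase F m]
    rw [Finsupp.single_add]
    abel
  have hle : ∀ u ≤ m + (w₀ + Finsupp.single F e), u F = 0 → u ≤ m.erase F + w₀ := by
    intro u hu hF
    rw [hsplit] at hu
    exact le_of_le_add_single hu hF
  constructor
  · rintro ⟨hHR, hdef⟩
    obtain ⟨u, hu, hdu⟩ := (hdef G).2 le_rfl
    have h1 := hHR u hu
    -- `G` and the join of `u` bound each other
    have hG : G ≤ supportSup u := by
      by_contra hG
      have := hmono (right_lt_sup.2 hG)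
      omega
    have hG' : supportSup u ≤ G := by
      refine (hdef _).1 ⟨u, hu, ?_⟩
      rw [sup_idem]
      rwa [sup_eq_right.2 hG] at hdu
    have hGu : supportSup u = G := le_antisymm hG' hG
    rw [hGu] at h1 hdu
    rw [sup_idem] at hdu
    have huF : u F = 0 := by
      by_contra h
      exact hGF.not_ge ((le_supportSup h).trans hG')
    have hu' := hle u hu huF
    have hdeg' : (m.erase F + w₀).degree ≤ u.degree := by
      rw [map_add]; omega
    have heq := eq_of_le_of_degree_le hu' hdeg'
    have := congrArg Finsupp.degree heq
    rw [map_add] at this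
    refine ⟨by omega, fun H hH => ?_, ?_⟩
    · refine (le_supportSup ?_).trans hG'
      rw [heq, Finsupp.add_apply]
      omega
    · exact heq ▸ hHR.mono hu
  · rintro ⟨hmF, hm, hHR⟩
    have hdv : (m.erase F + w₀).degree = rk G := by rw [map_add]; omega
    have hsupp : supportSup (m.erase F + w₀) ≤ G := supportSup_le.2 fun H hH => by
      rw [Finsupp.add_apply] at hH
      by_cases h : m.erase F H = 0
      · exact hw H (by omega)
      · exact hm H h
    have hbig : ∀ u ≤ m + (w₀ + Finsupp.single F e), u F ≠ 0 → ∀ H,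
        u.degree < rk (H ⊔ supportSup u) := by
      intro u hu hF H
      have h1 := Finsupp.degree_mono hu
      rw [hsplit, map_add, hdv, Finsupp.degree_single] at h1
      have h2 := hmono.monotone ((le_supportSup hF).trans (le_sup_right (a := H)))
      omega
    have hHR' : HallRado rk (m + (w₀ + Finsupp.single F e)) := by
      intro u hu
      by_cases hF : u F = 0
      · exact hHR u (hle u hu hF)
      · have := hbig u hu hF ⊥
        rw [bot_sup_eq] at this
        exact this.le
    have hGdef : ∀ H ≤ G, IsDeficient rk (m + (w₀ + Finsupp.single F e)) H := fun H hH => by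
      refine ⟨m.erase F + w₀, by rw [hsplit]; simp, ?_⟩
      rw [hdv]
      exact hmono.monotone (sup_le hH hsupp)
    refine ⟨hHR', fun H => ⟨fun h => ?_, hGdef H⟩⟩
    obtain ⟨u, hu, hdu⟩ := h.sup hmono hsub hHR' (hGdef G le_rfl)
    have huF : u F = 0 := by
      by_contra hF
      exact absurd (hbig u hu hF (H ⊔ G)) (by omega)
    have h1 := Finsupp.degree_mono (hle u hu huF)
    by_contra hHG
    have h2 : rk G < rk (H ⊔ G) := hmono (right_lt_sup.2 hHG)
    have h3 : rk (H ⊔ G) ≤ rk (H ⊔ G ⊔ supportSup u) := hmono.monotone le_sup_left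
    omega

variable [Fintype L]

open scoped Classical in
/-- A linear relation between the Hall–Rado indicator functions of multisets below `F`, each with
at least `a` copies of `F`, restricts to a relation between those which have exactly `a` copies of
`F` and all of whose other members lie below a given `G < F`. -/
lemma sum_hallRado_erase_eq_zero (hmono : StrictMono rk) (hbot : rk ⊥ = 0)
    (hsub : ∀ a b, rk (a ⊔ b) + rk (a ⊓ b) ≤ rk a + rk b) {ι : Type*} (T : Finset ι)
    (m : ι → L →₀ ℕ) (c : ι → ℚ) {F G : L} (hGF : G < F) {a d : ℕ} (ha : a + 1 + rk G ≤ rk F)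
    (hT : ∀ i ∈ T, (∀ H, m i H ≠ 0 → H ≤ F) ∧ (m i).degree = a + d ∧ a ≤ m i F)
    (hrel : ∀ w : L →₀ ℕ, (∀ H, w H ≠ 0 → H ≤ F) → w.degree + (a + d) = rk F →
      ∑ i ∈ T with HallRado rk (m i + w), c i = 0)
    (w₀ : L →₀ ℕ) (hw : ∀ H, w₀ H ≠ 0 → H ≤ G) (hw₀ : w₀.degree + d = rk G) :
    ∑ i ∈ T with m i F = a ∧ ∀ H, (m i).erase F H ≠ 0 → H ≤ G,
      (if HallRado rk ((m i).erase F + w₀) then c i else 0) = 0 := by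
  obtain ⟨e, he⟩ : ∃ e, a + e + 1 + rk G = rk F := ⟨rk F - rk G - 1 - a, by omega⟩
  set w₁ := w₀ + Finsupp.single F e with hw₁
  set S := T.filter fun i => HallRado rk (m i + w₁) with hS
  have hw₁F : ∀ H, w₁ H ≠ 0 → H ≤ F := by
    intro H hH
    rw [hw₁, Finsupp.add_apply, Finsupp.single_apply] at hH
    split_ifs at hH with h
    · exact h.ge
    · exact (hw H (by omega)).trans hGF.le
  have hw₁d : w₁.degree + 1 + (a + d) = rk F := by
    rw [hw₁, map_add, Finsupp.degree_single]; omega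
  have hrel1 : ∀ H ≤ F, ∑ i ∈ S with ¬ IsDeficient rk (m i + w₁) H, c i = 0 := by
    intro H hH
    rw [hS, Finset.filter_filter]
    rw [← hrel (w₁ + Finsupp.single H 1)]
    · refine Finset.sum_congr (Finset.filter_congr fun i _ => ?_) fun _ _ => rfl
      rw [← add_assoc (m i) w₁, hallRado_add_single]
    · intro K hK
      rw [Finsupp.add_apply, Finsupp.single_apply] at hK
      split_ifs at hK with h
      · exact h ▸ hH
      · exact hw₁F K (by omega)
    · rw [map_add, Finsupp.degree_single, hw₁d]
  have hle : ∀ i ∈ S, ∀ H, IsDeficient rk (m i + w₁) H → H ≤ F := by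
    rintro i hi H ⟨u, hu, hdu⟩
    obtain ⟨hi, hHR⟩ := Finset.mem_filter.1 hi
    have h1 := hHR u hu
    by_contra hH
    have h2 : supportSup u ≤ F := supportSup_le.2 fun K hK => by
      have := hu K
      rw [Finsupp.add_apply] at this
      by_cases h : m i K = 0
      · exact hw₁F K (by omega)
      · exact (hT i hi).1 K h
    have h3 := hmono (right_lt_sup.2 fun h => hH (h.trans h2))
    omega
  have hF : ∀ i ∈ S, ¬ IsDeficient rk (m i + w₁) F := by
    rintro i hi ⟨u, hu, hdu⟩
    have h1 := Finsupp.degree_mono hu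
    rw [map_add, (hT i (Finset.mem_filter.1 hi).1).2.1] at h1
    have h2 : rk F ≤ rk (F ⊔ supportSup u) := hmono.monotone le_sup_left
    omega
  have hZ : ∀ i, ∃ Z, i ∈ S → ∀ H, IsDeficient rk (m i + w₁) H ↔ H ≤ Z := by
    intro i
    by_cases hi : i ∈ S
    · obtain ⟨Z, h⟩ := exists_isDeficient_iff_le hmono hbot hsub (Finset.mem_filter.1 hi).2
      exact ⟨Z, fun _ => h⟩
    · exact ⟨⊥, fun h => absurd h hi⟩
  choose Z hZ using hZ
  have hrel2 : ∀ H, ∑ i ∈ S with H ≤ Z i, c i = 0 := by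
    intro H
    by_cases hH : H ≤ F
    · have h1 := Finset.sum_filter_add_sum_filter_not S
        (fun i => IsDeficient rk (m i + w₁) H) c
      rw [hrel1 H hH, add_zero] at h1
      have h2 := hrel1 F le_rfl
      rw [Finset.filter_true_of_mem hF] at h2
      rw [← h2, ← h1]
      exact Finset.sum_congr (Finset.filter_congr fun i hi => (hZ i hi H).symm) fun _ _ => rfl
    · rw [Finset.filter_false_of_mem, Finset.sum_empty]
      exact fun i hi h => hH (hle i hi H ((hZ i hi H).2 h))
  have hfin := sum_fiber_eq_zero S Z c hrel2 G
  rw [← Finset.sum_filter, Finset.filter_filter, ← hfin, hS, Finset.filter_filter]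
  refine Finset.sum_congr (Finset.filter_congr fun i hi => ?_) fun _ _ => rfl
  have key := isDeficient_iff_le_iff hmono hsub hGF he (hT i hi).2.1 (hT i hi).2.2 hw hw₀
  rw [and_assoc, ← key]
  refine and_congr_right fun hHR => ?_
  have hiS : i ∈ S := Finset.mem_filter.2 ⟨hi, hHR⟩
  constructor
  · exact fun h => le_antisymm ((h _).1 ((hZ i hiS _).2 le_rfl)) ((hZ i hiS _).1 ((h _).2 le_rfl))
  · rintro rfl
    exact hZ i hiS

open scoped Classical in
/-- The Hall–Rado indicator functions `w ↦ [HallRado (m + w)]` of the standard exponent vectors `m`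
of a fixed degree are linearly independent; it suffices to test complementary degrees. The proof
removes the greatest member `F` of the vectors: among those with a nonzero coefficient, the ones
with the fewest copies of `F` satisfy a linear relation below every `G < F`. -/
lemma eq_zero_of_sum_hallRado_eq_zero (hmono : StrictMono rk) (hbot : rk ⊥ = 0)
    (hsub : ∀ a b, rk (a ⊔ b) + rk (a ⊓ b) ≤ rk a + rk b) {ι : Type*} (F : L) :
    ∀ (d : ℕ) (T : Finset ι) (m : ι → L →₀ ℕ) (c : ι → ℚ), Set.InjOn m T →
    (∀ i ∈ T, IsStandard rk (m i) ∧ (∀ H, m i H ≠ 0 → H ≤ F) ∧ (m i).degree = d) →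
    (∀ w : L →₀ ℕ, (∀ H, w H ≠ 0 → H ≤ F) → w.degree + d = rk F →
      ∑ i ∈ T with HallRado rk (m i + w), c i = 0) → ∀ i ∈ T, c i = 0 := by
  induction F using (wellFounded_lt (α := L)).induction with
  | _ F ih =>
    intro d T m c hinj hT hrel
    by_contra! hne
    set S := T.filter fun i => c i ≠ 0 with hS
    have hSne : S.Nonempty := by
      obtain ⟨i, hi, hci⟩ := hne
      exact ⟨i, Finset.mem_filter.2 ⟨hi, hci⟩⟩
    obtain ⟨i₀, hi₀, hmin⟩ := Finset.exists_min_image S (fun i => m i F) hSne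
    have hST : ∀ i ∈ S, i ∈ T := fun i hi => (Finset.mem_filter.1 hi).1
    obtain ⟨hstd, hleF, hdeg⟩ := hT i₀ (hST i₀ hi₀)
    have hc₀ : c i₀ ≠ 0 := (Finset.mem_filter.1 hi₀).2
    have hrelS : ∀ w : L →₀ ℕ, (∀ H, w H ≠ 0 → H ≤ F) → w.degree + d = rk F →
        ∑ i ∈ S with HallRado rk (m i + w), c i = 0 := by
      intro w h1 h2
      rw [← hrel w h1 h2, hS, Finset.filter_filter]
      refine Finset.sum_subset (fun i hi => ?_) fun i hi hi' => ?_
      · rw [Finset.mem_filter] at hi ⊢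
        exact ⟨hi.1, hi.2.2⟩
      · rw [Finset.mem_filter] at hi hi'
        by_contra h
        exact hi' ⟨hi.1, h, hi.2⟩
    set a := m i₀ F with ha
    have hdege := degree_erase F (m i₀)
    by_cases h0 : (m i₀).erase F = 0
    · -- all vectors in the relation are powers of `F`
      rw [h0, map_zero, zero_add] at hdege
      have hSi : ∀ i ∈ S, m i = Finsupp.single F a := by
        intro i hi
        have h1 := degree_erase F (m i)
        have h2 := (hT i (hST i hi)).2.2
        have h3 := hmin i hi
        have h4 : (m i).erase F = 0 := by
          rw [← Finsupp.degree_eq_zero_iff]; omega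
        rw [← Finsupp.single_add_erase F (m i), h4, add_zero]
        congr 1
        omega
      have hSs : S = {i₀} := Finset.eq_singleton_iff_unique_mem.2 ⟨hi₀, fun i hi =>
        hinj (hST i hi) (hST i₀ hi₀) ((hSi i hi).trans (hSi i₀ hi₀).symm)⟩
      have haF := hstd.le F
      have h5 := hrelS (Finsupp.single F (rk F - a)) (fun H hH => by
        rw [Finsupp.single_apply] at hH
        split_ifs at hH with h
        · exact h.ge
        · exact absurd rfl hH) (by rw [Finsupp.degree_single]; omega)
      have hHR : HallRado rk (m i₀ + Finsupp.single F (rk F - a)) := by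
        rw [hSi i₀ hi₀, ← Finsupp.single_add]
        intro u hu
        by_cases huF : u F = 0
        · have : u ≤ 0 := le_of_le_add_single (k := a + (rk F - a)) (by simpa using hu) huF
          rw [le_zero_iff.1 this]
          simp
        · have h1 := Finsupp.degree_mono hu
          rw [Finsupp.degree_single] at h1
          have h2 := hmono.monotone (le_supportSup huF)
          omega
      rw [hSs, Finset.filter_singleton, if_pos hHR, Finset.sum_singleton] at h5
      exact hc₀ h5
    · obtain ⟨G, hG⟩ := Finset.exists_maximal (Finsupp.support_nonempty_iff.2 h0)
      have hGm := hG.prop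
      rw [Finsupp.support_erase, Finset.mem_erase] at hGm
      obtain ⟨hGF, hGm⟩ := hGm
      have hGlt : G < F := lt_of_le_of_ne (hleF G (Finsupp.mem_support_iff.1 hGm)) hGF
      have hgap : a + 1 + rk G ≤ rk F := by
        by_cases ha0 : a = 0
        · have := hmono hGlt; omega
        · have := hstd.gap G hGm F (Finsupp.mem_support_iff.2 ha0) hGlt
          omega
      obtain ⟨d', rfl⟩ : ∃ d', d = a + d' := ⟨d - a, by omega⟩
      refine hc₀ (ih G hGlt d'
        (S.filter fun i => m i F = a ∧ ∀ H, (m i).erase F H ≠ 0 → H ≤ G)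
        (fun i => (m i).erase F) c ?_ ?_ ?_ i₀ ?_)
      · intro i hi j hj hij
        simp only [Finset.coe_filter, Set.mem_ofPred_eq] at hi hj hij
        refine hinj (hST i hi.1) (hST j hj.1) ?_
        rw [← Finsupp.single_add_erase F (m i), ← Finsupp.single_add_erase F (m j), hij, hi.2.1,
          hj.2.1]
      · intro i hi
        obtain ⟨hi, hiF, hile⟩ := Finset.mem_filter.1 hi
        obtain ⟨hs, -, hd⟩ := hT i (hST i hi)
        refine ⟨?_, hile, ?_⟩
        · have hsub' : ∀ H ∈ ((m i).erase F).support, H ∈ (m i).support ∧ H ≠ F := fun H hH => by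
            rw [Finsupp.support_erase, Finset.mem_erase] at hH
            exact ⟨hH.2, hH.1⟩
          refine ⟨fun A hA B hB => hs.chain A (hsub' A hA).1 B (hsub' B hB).1, fun A => ?_,
            fun A hA B hB hAB => ?_⟩
          · by_cases hA : A = F
            · rw [hA, Finsupp.erase_same]; omega
            · rw [Finsupp.erase_ne hA]; exact hs.le A
          · rw [Finsupp.erase_ne (hsub' B hB).2]
            exact hs.gap A (hsub' A hA).1 B (hsub' B hB).1 hAB
        · have := degree_erase F (m i)
          omega
      · intro w hw hwd
        rw [Finset.sum_filter]
        exact sum_hallRado_erase_eq_zero hmono hbot hsub S m c hGlt hgap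
          (fun i hi => ⟨(hT i (hST i hi)).2.1, (hT i (hST i hi)).2.2, hmin i hi⟩) hrelS w hw hwd
      · refine Finset.mem_filter.2 ⟨hi₀, rfl, fun H hH => ?_⟩
        have hH' : H ∈ ((m i₀).erase F).support := Finsupp.mem_support_iff.2 hH
        have hH2 := hH'
        rw [Finsupp.support_erase, Finset.mem_erase] at hH'
        rcases hstd.chain H hH'.2 G hGm with h | h
        · exact h
        · exact (hG.eq_of_ge hH2 h).le

end Independence
end ChainPoset

/-! ### The lattice of flats -/

namespace Matroid

variable {α : Type*} (M : Matroid α)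

lemma IsFlat.closure_subset {F X : Set α} {M : Matroid α} (hF : M.IsFlat F) (h : X ⊆ F) :
    M.closure X ⊆ F :=
  (M.closure_subset_closure h).trans hF.closure.subset

lemma IsFlat.inter_flat {F G : Set α} {M : Matroid α} (hF : M.IsFlat F) (hG : M.IsFlat G) :
    M.IsFlat (F ∩ G) :=
  isFlat_iff_closure_eq.2 <| Set.Subset.antisymm
    (Set.subset_inter (hF.closure_subset Set.inter_subset_left)
      (hG.closure_subset Set.inter_subset_right))
    (M.subset_closure _ (Set.inter_subset_left.trans hF.subset_ground))

/-- The lattice structure on the flats: meets are intersections, joins are closures of unions. -/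
scoped instance instLatticeFlats : Lattice M.Flats where
  sup F G := ⟨M.closure (F.1 ∪ G.1), M.isFlat_closure _⟩
  inf F G := ⟨F.1 ∩ G.1, F.2.inter_flat G.2⟩
  le_sup_left F G := Set.subset_union_left.trans
    (M.subset_closure _ (Set.union_subset F.2.subset_ground G.2.subset_ground))
  le_sup_right F G := Set.subset_union_right.trans
    (M.subset_closure _ (Set.union_subset F.2.subset_ground G.2.subset_ground))
  sup_le _ _ H hF hG := H.2.closure_subset (Set.union_subset hF hG)
  inf_le_left _ _ := Set.inter_subset_left
  inf_le_right _ _ := Set.inter_subset_right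
  le_inf _ _ _ hF hG := Set.subset_inter hF hG

/-- The rank of a flat as a natural number. -/
noncomputable def flatRank (F : M.Flats) : ℕ := (M.eRk F.1).toNat

/-- The flat spanned by an element. -/
def pointFlat (e : α) : M.Flats := ⟨M.closure {e}, M.isFlat_closure _⟩

variable {M}

lemma coe_sup (F G : M.Flats) : (F ⊔ G).1 = M.closure (F.1 ∪ G.1) := rfl

lemma pointFlat_le_iff {e : α} (he : e ∈ M.E) {F : M.Flats} : M.pointFlat e ≤ F ↔ e ∈ F.1 := by
  constructor
  · exact fun h => h (M.mem_closure_self e)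
  · exact fun h => F.2.closure_subset (Set.singleton_subset_iff.2 h)

lemma sup_pointFlat (F : M.Flats) (e : α) : (F ⊔ M.pointFlat e).1 = M.closure (insert e F.1) := by
  rw [coe_sup, pointFlat, closure_union_closure_right_eq, Set.union_singleton]

lemma flatRank_bot : M.flatRank ⊥ = 0 := by
  have : M.eRk (M.closure ∅) = 0 := by rw [eRk_closure_eq, eRk_empty]
  rw [flatRank]
  exact congrArg ENat.toNat this

lemma flatRank_top {n : ℕ} (h : M.eRank = n) : M.flatRank ⊤ = n := by
  have : M.eRk M.E = n := by rw [eRk_ground, h]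
  rw [flatRank]
  exact congrArg ENat.toNat this

lemma exists_eq_sup_pointFlat {F G : M.Flats} (h : F ⋖ G) :
    ∃ e ∈ M.E, ¬ M.pointFlat e ≤ F ∧ G = F ⊔ M.pointFlat e := by
  obtain ⟨e, heG, heF⟩ := Set.exists_of_ssubset (show F.1 ⊂ G.1 from h.lt)
  have heE := G.2.subset_ground heG
  have hnot : ¬ M.pointFlat e ≤ F := fun h => heF ((pointFlat_le_iff heE).1 h)
  refine ⟨e, heE, hnot, ?_⟩
  have h1 : F ⊔ M.pointFlat e ≤ G := sup_le h.le ((pointFlat_le_iff heE).2 heG)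
  by_contra hne
  exact h.2 (left_lt_sup.2 hnot) (lt_of_le_of_ne h1 (Ne.symm hne))

variable [M.Finite]

lemma coe_flatRank (F : M.Flats) : (M.flatRank F : ℕ∞) = M.eRk F.1 :=
  ENat.natCast_toNat (M.eRk_ne_top_iff.2 (M.isRkFinite_set _))

lemma flatRank_strictMono : StrictMono M.flatRank := by
  intro F G hFG
  have h1 : M.flatRank F ≤ M.flatRank G := by
    rw [← Nat.cast_le (α := ℕ∞), coe_flatRank, coe_flatRank]
    exact M.eRk_mono hFG.le
  refine lt_of_le_of_ne h1 fun h => hFG.ne ?_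
  have h2 : M.eRk G.1 ≤ M.eRk F.1 := by rw [← coe_flatRank, ← coe_flatRank, h]
  have h3 := (M.isRkFinite_set F.1).closure_eq_closure_of_subset_of_eRk_ge_eRk hFG.le h2
  rw [F.2.closure, G.2.closure] at h3
  exact Subtype.ext h3

lemma flatRank_sup_add_inf_le (F G : M.Flats) :
    M.flatRank (F ⊔ G) + M.flatRank (F ⊓ G) ≤ M.flatRank F + M.flatRank G := by
  have h := M.eRk_inter_add_eRk_union_le F.1 G.1
  rw [← Nat.cast_le (α := ℕ∞), Nat.cast_add, Nat.cast_add, coe_flatRank, coe_flatRank, coe_flatRank,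
    coe_flatRank, coe_sup, eRk_closure_eq, add_comm]
  exact h

lemma flatRank_sup_pointFlat_le (F : M.Flats) (e : α) :
    M.flatRank (F ⊔ M.pointFlat e) ≤ M.flatRank F + 1 := by
  rw [← Nat.cast_le (α := ℕ∞), Nat.cast_add, coe_flatRank, coe_flatRank, sup_pointFlat,
    eRk_closure_eq]
  exact M.eRk_insert_le_add_one e F.1

lemma flatRank_covBy (F G : M.Flats) (h : F ⋖ G) : M.flatRank G = M.flatRank F + 1 := by
  obtain ⟨e, -, -, rfl⟩ := exists_eq_sup_pointFlat h
  have h1 := flatRank_sup_pointFlat_le F e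
  have h2 := flatRank_strictMono h.lt
  omega

end Matroid

/-! ### Sums over principal upper sets -/

namespace Matroid

section UpSums

variable {L : Type*} [PartialOrder L] [Fintype L] [DecidableLE L]

lemma eq_of_sum_upper_eq {V : Type*} [AddCommGroup V] {f g : L → V}
    (h : ∀ F, ∑ G with F ≤ G, f G = ∑ G with F ≤ G, g G) (F : L) : f F = g F := by
  classical
  induction F using (wellFounded_gt (α := L)).induction with
  | _ F ih =>
    have hF : F ∈ (Finset.univ.filter fun G => F ≤ G) := by simp
    have h1 := h F
    rw [← Finset.add_sum_erase _ _ hF, ← Finset.add_sum_erase _ _ hF] at h1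
    rw [Finset.sum_congr rfl fun G hG => ih G ?_] at h1
    · exact add_right_cancel h1
    · rw [Finset.mem_erase, Finset.mem_filter] at hG
      exact lt_of_le_of_ne hG.2.2 hG.1.symm

/-- Möbius inversion over the upper sets of a finite poset, inside a given submodule. -/
lemma exists_sum_upper_eq {R V : Type*} [Ring R] [AddCommGroup V] [Module R V] (W : Submodule R V)
    (g : L → V) (hg : ∀ F, g F ∈ W) :
    ∃ f : L → V, (∀ F, f F ∈ W) ∧ ∀ F, ∑ G with F ≤ G, f G = g F := by
  classical
  let f : L → V := (wellFounded_gt (α := L)).fix fun F ih =>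
    g F - ∑ G : {G // F < G}, ih G.1 G.2
  have hf : ∀ F, f F = g F - ∑ G : {G // F < G}, f G.1 := fun F =>
    (wellFounded_gt (α := L)).fix_eq _ F
  refine ⟨f, fun F => ?_, fun F => ?_⟩
  · induction F using (wellFounded_gt (α := L)).induction with
    | _ F ih =>
      rw [hf]
      exact W.sub_mem (hg F) (W.sum_mem fun G _ => ih G.1 G.2)
  · have hF : F ∈ (Finset.univ.filter fun G => F ≤ G) := by simp
    rw [← Finset.add_sum_erase _ _ hF, hf F]
    have : ∑ G : {G // F < G}, f G.1 = ∑ G ∈ (Finset.univ.filter fun G => F ≤ G).erase F, f G := by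
      rw [← Finset.sum_subtype_of_mem (p := fun G => F < G) f]
      · refine Finset.sum_congr ?_ fun _ _ => rfl
        ext G
        simp [G.2.le, G.2.ne']
      · intro G hG
        rw [Finset.mem_erase, Finset.mem_filter] at hG
        exact lt_of_le_of_ne hG.2.2 hG.1.symm
    rw [this]
    abel

lemma sum_upper_sub_sum_upper_sup {L : Type*} [Lattice L] [Fintype L] [DecidableLE L] {V : Type*}
    [AddCommGroup V] (f : L → V) (F G : L) :
    ∑ A with F ≤ A, f A - ∑ A with F ⊔ G ≤ A, f A = ∑ A with F ≤ A ∧ ¬ G ≤ A, f A := by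
  rw [sub_eq_iff_eq_add', ← Finset.sum_filter_add_sum_filter_not {A | F ≤ A} (fun A => G ≤ A),
    Finset.filter_filter, Finset.filter_filter]
  simp only [sup_le_iff]

end UpSums

/-! ### Relations in the augmented Chow ring -/

section ChowRing

variable {α : Type*} (M : Matroid α) [M.Finite]

open scoped Classical in
/-- The linear form `h_F`, the sum of the `x_G` over the proper flats `G` that do not contain
`F`. -/
noncomputable def chowH (F : M.Flats) : M.ChowVars := ∑ G : M.ProperFlats with ¬ F ≤ G.1, M.chowX G

/-- The image of `h_F` in the augmented Chow ring. -/
noncomputable def chowRingH (F : M.Flats) : M.AugmentedChowRing :=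
  Ideal.Quotient.mk M.augmentedChowIdeal (M.chowH F)

/-- The homomorphism from the polynomial ring in variables indexed by the flats to the augmented
Chow ring that sends the variable of `F` to `h_F`. -/
noncomputable def simplicialMap : MvPolynomial M.Flats ℚ →ₐ[ℚ] M.AugmentedChowRing :=
  MvPolynomial.aeval M.chowRingH

variable {M}

lemma chowX_mul_chowX_mem {F G : M.ProperFlats} (h1 : ¬ F.1 ≤ G.1) (h2 : ¬ G.1 ≤ F.1) :
    M.chowX F * M.chowX G ∈ M.augmentedChowIdeal :=
  Ideal.subset_span (Or.inl (Or.inr ⟨F, G, h1, h2, rfl⟩))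

lemma chowY_mul_chowX_mem {i : M.E} {F : M.ProperFlats} (h : (i : α) ∉ F.1.1) :
    M.chowY i * M.chowX F ∈ M.augmentedChowIdeal :=
  Ideal.subset_span (Or.inr ⟨i, F, h, rfl⟩)

open scoped Classical in
lemma chowH_pointFlat (i : M.E) :
    M.chowH (M.pointFlat i) = ∑ F : M.ProperFlats with (i : α) ∉ F.1.1, M.chowX F := by
  rw [chowH]
  simp only [pointFlat_le_iff i.2]

lemma mk_chowY (i : M.E) :
    Ideal.Quotient.mk M.augmentedChowIdeal (M.chowY i) = M.chowRingH (M.pointFlat i) := by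
  classical
  rw [chowRingH, chowH_pointFlat, Ideal.Quotient.eq]
  exact Ideal.subset_span (Or.inl (Or.inl ⟨i, rfl⟩))

lemma chowRingH_bot : M.chowRingH ⊥ = 0 := by
  simp [chowRingH, chowH]

open scoped Classical in
lemma chowH_sub_chowH_sup (F G : M.Flats) :
    M.chowH F - M.chowH (F ⊔ G) =
      -∑ A : M.ProperFlats with F ≤ A.1 ∧ ¬ G ≤ A.1, M.chowX A := by
  rw [sub_eq_iff_eq_add', ← sub_eq_add_neg, eq_sub_iff_add_eq, chowH, chowH,
    ← Finset.sum_union]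
  · refine Finset.sum_congr ?_ fun _ _ => rfl
    ext A
    simp only [Finset.mem_union, Finset.mem_filter, Finset.mem_univ, true_and, sup_le_iff]
    tauto
  · rw [Finset.disjoint_left]
    intro A hA hA'
    simp only [Finset.mem_filter, Finset.mem_univ, true_and] at hA hA'
    exact hA hA'.1

lemma chowRingH_straightening (F G : M.Flats) :
    (M.chowRingH F - M.chowRingH (F ⊔ G)) * (M.chowRingH G - M.chowRingH (F ⊔ G)) = 0 := by
  classical
  simp only [chowRingH, ← map_sub, ← map_mul]
  rw [Ideal.Quotient.eq_zero_iff_mem, chowH_sub_chowH_sup, sup_comm F G, chowH_sub_chowH_sup,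
    neg_mul_neg, Finset.sum_mul_sum]
  refine Ideal.sum_mem _ fun A hA => Ideal.sum_mem _ fun B hB => ?_
  simp only [Finset.mem_filter, Finset.mem_univ, true_and] at hA hB
  exact chowX_mul_chowX_mem (fun h => hB.2 (hA.1.trans h)) fun h => hA.2 (hB.1.trans h)

lemma chowRingH_pointFlat_mul (F : M.Flats) {e : α} (he : e ∈ M.E) :
    M.chowRingH (M.pointFlat e) * (M.chowRingH F - M.chowRingH (F ⊔ M.pointFlat e)) = 0 := by
  classical
  rw [← mk_chowY ⟨e, he⟩]
  simp only [chowRingH, ← map_sub, ← map_mul]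
  rw [Ideal.Quotient.eq_zero_iff_mem, chowH_sub_chowH_sup, mul_neg, Finset.mul_sum, neg_mem_iff]
  refine Ideal.sum_mem _ fun A hA => ?_
  simp only [Finset.mem_filter, Finset.mem_univ, true_and] at hA
  exact chowY_mul_chowX_mem fun h => hA.2 ((pointFlat_le_iff he).2 h)

lemma chowRingH_covBy {F G : M.Flats} (h : F ⋖ G) :
    (M.chowRingH F - M.chowRingH G) * M.chowRingH G = 0 := by
  obtain ⟨e, he, -, rfl⟩ := exists_eq_sup_pointFlat h
  linear_combination chowRingH_pointFlat_mul F he - chowRingH_straightening F (M.pointFlat e)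

/-- In a product with `h_G ^ (rk G - rk F)`, the factor `h_F` may be replaced by `h_G`. -/
lemma chowRingH_sub_mul_pow (k : ℕ) : ∀ {F G : M.Flats}, F ≤ G →
    M.flatRank G = M.flatRank F + k →
    (M.chowRingH F - M.chowRingH G) * M.chowRingH G ^ k = 0 := by
  induction k with
  | zero =>
    intro F G hFG hk
    rw [hFG.eq_of_not_lt fun h => by have := flatRank_strictMono h; omega]
    simp
  | succ k ih =>
    intro F G hFG hk
    have hlt : F < G := lt_of_le_of_ne hFG fun h => by rw [h] at hk; omega
    obtain ⟨F', hF', hF'G⟩ := exists_covBy_le_of_lt hlt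
    have h1 := flatRank_covBy F F' hF'
    have h2 := ih hF'G (by omega)
    have h3 := chowRingH_covBy hF'
    rw [pow_succ]
    linear_combination (M.chowRingH G - (M.chowRingH F - M.chowRingH F')) * h2 +
      M.chowRingH G ^ k * h3

lemma chowRingH_pow_eq_zero (G : M.Flats) : M.chowRingH G ^ (M.flatRank G + 1) = 0 := by
  have := chowRingH_sub_mul_pow (M.flatRank G) (bot_le (a := G)) (by rw [flatRank_bot, zero_add])
  rw [chowRingH_bot] at this
  rw [pow_succ']
  linear_combination -this

end ChowRing

end Matroid

/-! ### Standard monomials span the augmented Chow ring -/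

namespace Matroid

open ChainPoset

section Spanning

open MvPolynomial

lemma exists_add_single_of_ne_zero {L : Type*} {m : L →₀ ℕ} {F G : L} (hFG : F ≠ G) {k : ℕ}
    (hF : m F ≠ 0) (hG : k ≤ m G) :
    ∃ v, m = v + (Finsupp.single F 1 + Finsupp.single G k) := by
  classical
  refine ⟨m - (Finsupp.single F 1 + Finsupp.single G k), (tsub_add_cancel_of_le fun H => ?_).symm⟩
  simp only [Finsupp.add_apply, Finsupp.single_apply]
  split_ifs with h1 h2 h2
  · exact absurd (h1.trans h2.symm) hFG
  · subst h1; omega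
  · subst h2; omega
  · omega

variable {α : Type*} {M : Matroid α}

/-- The sum of the ranks of the members of a multiset of flats. -/
noncomputable def rankWeight (m : M.Flats →₀ ℕ) : ℕ := m.weight M.flatRank

lemma rankWeight_add (u v : M.Flats →₀ ℕ) : rankWeight (u + v) = rankWeight u + rankWeight v :=
  map_add _ _ _

lemma rankWeight_single (F : M.Flats) (k : ℕ) :
    rankWeight (Finsupp.single F k) = k * M.flatRank F := by
  simp [rankWeight, Finsupp.weight_single]

variable [M.Finite]

lemma simplicialMap_X (F : M.Flats) : M.simplicialMap (X F) = M.chowRingH F :=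
  aeval_X _ _

lemma simplicialMap_monomial_single (F : M.Flats) (k : ℕ) :
    M.simplicialMap (monomial (Finsupp.single F k) 1) = M.chowRingH F ^ k := by
  rw [← X_pow_eq_monomial, map_pow, simplicialMap_X]

lemma simplicialMap_monomial_add (u v : M.Flats →₀ ℕ) :
    M.simplicialMap (monomial (u + v) 1) =
      M.simplicialMap (monomial u 1) * M.simplicialMap (monomial v 1) := by
  rw [← map_mul, monomial_mul, one_mul]

lemma rankWeight_le (m : M.Flats →₀ ℕ) : rankWeight m ≤ m.degree * M.flatRank ⊤ := by
  rw [rankWeight, Finsupp.weight_apply, Finsupp.degree_apply, Finsupp.sum, Finset.sum_mul]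
  exact Finset.sum_le_sum fun F _ =>
    Nat.mul_le_mul_left _ (flatRank_strictMono.monotone le_top)

variable (M) in
/-- The span of the standard monomials of degree `d` in the augmented Chow ring. -/
noncomputable def standardSpan (d : ℕ) : Submodule ℚ M.AugmentedChowRing :=
  Submodule.span ℚ {p | ∃ m, IsStandard M.flatRank m ∧ m.degree = d ∧
    p = M.simplicialMap (monomial m 1)}

/-- Every monomial in the `h_F` is a combination of standard monomials. A monomial that is not
standard vanishes or is rewritten into monomials of the same degree whose members have a larger
sum of ranks. -/
lemma simplicialMap_monomial_mem (m : M.Flats →₀ ℕ) :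
    M.simplicialMap (monomial m 1) ∈ M.standardSpan m.degree := by
  induction hN : m.degree * M.flatRank ⊤ - rankWeight m using Nat.strong_induction_on
    generalizing m with
  | _ N ih =>
    have hstep : ∀ m' : M.Flats →₀ ℕ, m'.degree = m.degree → rankWeight m < rankWeight m' →
        M.simplicialMap (monomial m' 1) ∈ M.standardSpan m.degree := by
      intro m' hd hw
      have := rankWeight_le m'
      rw [← hd]
      refine ih _ ?_ m' rfl
      rw [hd] at this ⊢
      omega
    by_cases hstd : IsStandard M.flatRank m
    · exact Submodule.subset_span ⟨m, hstd, rfl, rfl⟩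
    by_cases h1 : ∀ F ∈ m.support, ∀ G ∈ m.support, F ≤ G ∨ G ≤ F
    · by_cases h2 : ∀ G, m G ≤ M.flatRank G
      · have h3 : ¬ ∀ F ∈ m.support, ∀ G ∈ m.support, F < G →
            m G + M.flatRank F < M.flatRank G := fun h3 => hstd ⟨h1, h2, h3⟩
        push Not at h3
        obtain ⟨F, hF, G, -, hFG, hgap⟩ := h3
        obtain ⟨k, hk⟩ := Nat.exists_eq_add_of_lt (flatRank_strictMono hFG)
        obtain ⟨v, rfl⟩ := exists_add_single_of_ne_zero hFG.ne (Finsupp.mem_support_iff.1 hF)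
          (show k + 1 ≤ m G by omega)
        have hrel := chowRingH_sub_mul_pow (k + 1) hFG.le hk
        have heq : M.simplicialMap
            (monomial (v + (Finsupp.single F 1 + Finsupp.single G (k + 1))) 1) =
            M.simplicialMap (monomial (v + Finsupp.single G (k + 2)) 1) := by
          simp only [simplicialMap_monomial_add, simplicialMap_monomial_single]
          linear_combination M.simplicialMap (monomial v 1) * hrel
        rw [heq]
        refine hstep _ ?_ ?_
        · simp only [map_add, Finsupp.degree_single]
          omega
        · simp only [rankWeight_add, rankWeight_single]
          have := flatRank_strictMono hFG
          linarith
      · push Not at h2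
        obtain ⟨G, hG⟩ := h2
        have hle : Finsupp.single G (M.flatRank G + 1) ≤ m := by
          classical
          intro H
          rw [Finsupp.single_apply]
          split_ifs with h
          · subst h; omega
          · omega
        rw [← tsub_add_cancel_of_le hle, simplicialMap_monomial_add, simplicialMap_monomial_single,
          chowRingH_pow_eq_zero, mul_zero]
        exact zero_mem _
    · push Not at h1
      obtain ⟨F, hF, G, hG, hFG, hGF⟩ := h1
      obtain ⟨v, rfl⟩ := exists_add_single_of_ne_zero (fun h => hFG h.le)
        (Finsupp.mem_support_iff.1 hF)
        (Nat.one_le_iff_ne_zero.2 (Finsupp.mem_support_iff.1 hG))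
      have hrel := chowRingH_straightening F G
      have heq : M.simplicialMap (monomial (v + (Finsupp.single F 1 + Finsupp.single G 1)) 1) =
          M.simplicialMap (monomial (v + (Finsupp.single F 1 + Finsupp.single (F ⊔ G) 1)) 1) +
          M.simplicialMap (monomial (v + (Finsupp.single G 1 + Finsupp.single (F ⊔ G) 1)) 1) -
          M.simplicialMap
            (monomial (v + (Finsupp.single (F ⊔ G) 1 + Finsupp.single (F ⊔ G) 1)) 1) := by
        simp only [simplicialMap_monomial_add, simplicialMap_monomial_single, pow_one]
        linear_combination M.simplicialMap (monomial v 1) * hrel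
      have hF' := flatRank_strictMono (left_lt_sup.2 hGF : F < F ⊔ G)
      have hG' := flatRank_strictMono (right_lt_sup.2 hFG : G < F ⊔ G)
      rw [heq]
      refine sub_mem (add_mem (hstep _ ?_ ?_) (hstep _ ?_ ?_)) (hstep _ ?_ ?_)
      all_goals simp only [map_add, Finsupp.degree_single, rankWeight_add, rankWeight_single]
      all_goals omega

end Spanning

end Matroid

/-! ### Standard monomials are linearly independent, and the Hilbert series -/

namespace Matroid

open ChainPoset

section Independence

open MvPolynomial

variable {α : Type*} (M : Matroid α)

variable {M} in
lemma monomial_mul_X (w : M.Flats →₀ ℕ) (F : M.Flats) :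
    monomial w (1 : ℚ) * X F = monomial (w + Finsupp.single F 1) 1 := by
  rw [X, monomial_mul, one_mul]

open scoped Classical in
/-- The linear functional on the polynomial ring in the variables of the flats whose value at a
monomial is `1` if the monomial satisfies the Hall–Rado condition and `0` otherwise. In degree
`rank M` it is the degree map of the augmented Chow ring. -/
noncomputable def hallRadoFunctional : MvPolynomial M.Flats ℚ →ₗ[ℚ] ℚ :=
  (basisMonomials M.Flats ℚ).constr ℚ fun m => if HallRado M.flatRank m then 1 else 0

/-- The largest ideal on which the Hall–Rado functional vanishes. -/
noncomputable def hallRadoIdeal : Ideal (MvPolynomial M.Flats ℚ) where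
  carrier := {p | ∀ q, M.hallRadoFunctional (p * q) = 0}
  add_mem' hp hp' q := by rw [add_mul, map_add, hp q, hp' q, add_zero]
  zero_mem' q := by rw [zero_mul, map_zero]
  smul_mem' r p hp q := by rw [smul_eq_mul, mul_comm r p, mul_assoc]; exact hp (r * q)

variable {M}

open scoped Classical in
lemma hallRadoFunctional_monomial (m : M.Flats →₀ ℕ) :
    M.hallRadoFunctional (monomial m 1) = if HallRado M.flatRank m then 1 else 0 := by
  have := (basisMonomials M.Flats ℚ).constr_basis ℚ
    (fun m => if HallRado M.flatRank m then (1 : ℚ) else 0) m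
  rwa [coe_basisMonomials] at this

lemma mem_hallRadoIdeal {p : MvPolynomial M.Flats ℚ}
    (h : ∀ w, M.hallRadoFunctional (monomial w 1 * p) = 0) : p ∈ M.hallRadoIdeal := by
  intro q
  rw [mul_comm, q.as_sum, Finset.sum_mul, map_sum]
  refine Finset.sum_eq_zero fun w _ => ?_
  have hw : monomial w (coeff w q) = coeff w q • monomial w (1 : ℚ) := by
    rw [smul_monomial, smul_eq_mul, mul_one]
  rw [hw, smul_mul_assoc, map_smul, h, smul_zero]

lemma X_bot_mem_hallRadoIdeal : X ⊥ ∈ M.hallRadoIdeal := by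
  refine mem_hallRadoIdeal fun w => ?_
  rw [monomial_mul_X, hallRadoFunctional_monomial,
    if_neg (not_hallRado_add_single_bot flatRank_bot w)]

variable [M.Finite]

lemma straightening_mem_hallRadoIdeal (F G : M.Flats) :
    (X F - X (F ⊔ G)) * (X G - X (F ⊔ G)) ∈ M.hallRadoIdeal := by
  refine mem_hallRadoIdeal fun w => ?_
  have h : monomial w (1 : ℚ) * ((X F - X (F ⊔ G)) * (X G - X (F ⊔ G))) =
      monomial w 1 * X F * X G - monomial w 1 * X F * X (F ⊔ G) -
        monomial w 1 * X G * X (F ⊔ G) + monomial w 1 * X (F ⊔ G) * X (F ⊔ G) := by ring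
  rw [h]
  simp only [monomial_mul_X, map_add, map_sub, hallRadoFunctional_monomial]
  exact hallRado_straightening flatRank_strictMono flatRank_sup_add_inf_le w F G

lemma pointFlat_mul_mem_hallRadoIdeal (F : M.Flats) (e : α) :
    X (M.pointFlat e) * (X F - X (F ⊔ M.pointFlat e)) ∈ M.hallRadoIdeal := by
  classical
  refine mem_hallRadoIdeal fun w => ?_
  rw [mul_sub, mul_sub, map_sub, ← mul_assoc, ← mul_assoc]
  simp only [monomial_mul_X, hallRadoFunctional_monomial]
  rw [sub_eq_zero]
  exact if_congr (hallRado_atom_iff (fun F => flatRank_sup_pointFlat_le F e) w F) rfl rfl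

open scoped Classical in
/-- The polynomials expressing the `x_F` in terms of the `h_F`. -/
lemma exists_inverse_chowH : ∃ ξ : M.Flats → MvPolynomial M.Flats ℚ,
    (∀ F, (ξ F).IsHomogeneous 1) ∧ ∀ F, ∑ G with F ≤ G, ξ G = -X F := by
  obtain ⟨ξ, h1, h2⟩ := exists_sum_upper_eq (homogeneousSubmodule M.Flats ℚ 1)
    (fun F : M.Flats => -X F) fun F => neg_mem (isHomogeneous_X ℚ F)
  exact ⟨ξ, h1, h2⟩

variable (M) in
/-- The linear polynomial in the variables of the flats that expresses `x_F` in terms of the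
`h_F`: it is determined by `∑_{G ≥ F} x_G = -h_F`, with the convention that the sum of all `x_G`,
including that for `G` the ground set, is `0`. -/
noncomputable def flatForm : M.Flats → MvPolynomial M.Flats ℚ := exists_inverse_chowH.choose

lemma isHomogeneous_flatForm (F : M.Flats) : (M.flatForm F).IsHomogeneous 1 :=
  exists_inverse_chowH.choose_spec.1 F

open scoped Classical in
lemma sum_flatForm (F : M.Flats) : ∑ G with F ≤ G, M.flatForm G = -X F :=
  exists_inverse_chowH.choose_spec.2 F

open scoped Classical in
lemma sum_flatForm_sdiff (F G : M.Flats) :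
    ∑ A with F ≤ A ∧ ¬ G ≤ A, M.flatForm A = -(X F - X (F ⊔ G)) := by
  rw [← sum_upper_sub_sum_upper_sup, sum_flatForm, sum_flatForm]
  ring

lemma flatForm_mul_mem_hallRadoIdeal (x : M.Flats × M.Flats) : ¬ x.1 ≤ x.2 → ¬ x.2 ≤ x.1 →
    M.flatForm x.1 * M.flatForm x.2 ∈ M.hallRadoIdeal := by
  classical
  induction x using (wellFounded_gt (α := M.Flats × M.Flats)).induction with
  | _ x ih =>
    obtain ⟨F, G⟩ := x
    intro h1 h2
    dsimp only at h1 h2 ⊢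
    have h3 := straightening_mem_hallRadoIdeal F G
    rw [← neg_mul_neg, ← sum_flatForm_sdiff, sup_comm F G, ← sum_flatForm_sdiff,
      Finset.sum_mul_sum, ← Finset.sum_product'] at h3
    have hmem : ((F, G) : M.Flats × M.Flats) ∈
        (Finset.univ.filter fun A => F ≤ A ∧ ¬ G ≤ A) ×ˢ
          (Finset.univ.filter fun B => G ≤ B ∧ ¬ F ≤ B) := by
      simp [h1, h2]
    rw [← Finset.add_sum_erase _ _ hmem] at h3
    refine (Submodule.add_mem_iff_left _ ?_).1 h3
    refine Submodule.sum_mem _ fun y hy => ?_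
    simp only [Finset.mem_erase, Finset.mem_product, Finset.mem_filter, Finset.mem_univ,
      true_and] at hy
    exact ih y (lt_of_le_of_ne ⟨hy.2.1.1, hy.2.2.1⟩ hy.1.symm)
      (fun h => hy.2.2.2 (hy.2.1.1.trans h)) fun h => hy.2.1.2 (hy.2.2.1.trans h)

lemma pointFlat_mul_flatForm_mem_hallRadoIdeal (e : α) (F : M.Flats) : ¬ M.pointFlat e ≤ F →
    X (M.pointFlat e) * M.flatForm F ∈ M.hallRadoIdeal := by
  classical
  induction F using (wellFounded_gt (α := M.Flats)).induction with
  | _ F ih =>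
    intro h1
    have h2 := neg_mem (pointFlat_mul_mem_hallRadoIdeal F e)
    rw [← mul_neg, ← sum_flatForm_sdiff, Finset.mul_sum] at h2
    have hmem : F ∈ Finset.univ.filter fun A => F ≤ A ∧ ¬ M.pointFlat e ≤ A := by simp [h1]
    rw [← Finset.add_sum_erase _ _ hmem] at h2
    refine (Submodule.add_mem_iff_left _ ?_).1 h2
    refine Submodule.sum_mem _ fun A hA => ?_
    simp only [Finset.mem_erase, Finset.mem_filter, Finset.mem_univ, true_and] at hA
    exact ih A (lt_of_le_of_ne hA.2.1 hA.1.symm) hA.2.2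

variable (M) in
/-- The homomorphism between polynomial rings that writes `x_F` and `y_i` in terms of the `h_F`. -/
noncomputable def toSimplicial : M.ChowVars →ₐ[ℚ] MvPolynomial M.Flats ℚ :=
  aeval (Sum.elim (fun F => M.flatForm F.1) fun i => X (M.pointFlat i))

lemma toSimplicial_chowX (F : M.ProperFlats) : M.toSimplicial (M.chowX F) = M.flatForm F.1 := by
  rw [toSimplicial, chowX, aeval_X, Sum.elim_inl]

lemma toSimplicial_chowY (i : M.E) : M.toSimplicial (M.chowY i) = X (M.pointFlat i) := by
  rw [toSimplicial, chowY, aeval_X, Sum.elim_inr]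

lemma toSimplicial_chowH (F : M.Flats) : M.toSimplicial (M.chowH F) = X F - X ⊥ := by
  classical
  have h1 : M.toSimplicial (M.chowH F) = ∑ A with ⊥ ≤ A ∧ ¬ F ≤ A, M.flatForm A := by
    simp only [chowH, map_sum, toSimplicial_chowX, bot_le, true_and]
    refine Finset.sum_bij (fun A _ => A.1) (fun A hA => by simpa using hA)
      (fun A _ B _ h => Subtype.ext h) (fun A hA => ?_) fun _ _ => rfl
    simp only [Finset.mem_filter, Finset.mem_univ, true_and] at hA
    exact ⟨⟨A, fun h => hA (h ▸ le_top)⟩, by simpa using hA, rfl⟩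
  rw [h1, sum_flatForm_sdiff, bot_sup_eq, neg_sub]

lemma augmentedChowIdeal_le_comap :
    M.augmentedChowIdeal ≤ M.hallRadoIdeal.comap M.toSimplicial := by
  classical
  rw [augmentedChowIdeal, Ideal.span_le]
  rintro p ((⟨i, rfl⟩ | ⟨F, G, h1, h2, rfl⟩) | ⟨i, F, h, rfl⟩)
  · rw [← chowH_pointFlat, SetLike.mem_coe, Ideal.mem_comap, map_sub, toSimplicial_chowY,
      toSimplicial_chowH, sub_sub_cancel]
    exact X_bot_mem_hallRadoIdeal
  · rw [SetLike.mem_coe, Ideal.mem_comap, map_mul, toSimplicial_chowX, toSimplicial_chowX]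
    exact flatForm_mul_mem_hallRadoIdeal (F.1, G.1) h1 h2
  · rw [SetLike.mem_coe, Ideal.mem_comap, map_mul, toSimplicial_chowX, toSimplicial_chowY]
    exact pointFlat_mul_flatForm_mem_hallRadoIdeal _ _ fun h' => h ((pointFlat_le_iff i.2).1 h')

lemma simplicialMap_eq_mk (q : MvPolynomial M.Flats ℚ) :
    M.simplicialMap q = Ideal.Quotient.mk M.augmentedChowIdeal (aeval M.chowH q) := by
  have : M.simplicialMap = (Ideal.Quotient.mkₐ ℚ M.augmentedChowIdeal).comp (aeval M.chowH) := by
    ext F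
    simp [simplicialMap, chowRingH]
  rw [this]
  rfl

/-- A relation between the `h_F` in the augmented Chow ring is killed by the Hall–Rado
functional. -/
lemma mem_hallRadoIdeal_of_simplicialMap_eq_zero {q : MvPolynomial M.Flats ℚ}
    (hq : M.simplicialMap q = 0) : q ∈ M.hallRadoIdeal := by
  rw [simplicialMap_eq_mk, Ideal.Quotient.eq_zero_iff_mem] at hq
  have h1 : M.toSimplicial (aeval M.chowH q) ∈ M.hallRadoIdeal := augmentedChowIdeal_le_comap hq
  have h2 : (Ideal.Quotient.mkₐ ℚ M.hallRadoIdeal).comp (M.toSimplicial.comp (aeval M.chowH)) =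
      Ideal.Quotient.mkₐ ℚ M.hallRadoIdeal := by
    ext F
    simp only [AlgHom.comp_apply, aeval_X, toSimplicial_chowH, map_sub]
    rw [sub_eq_self]
    exact Ideal.Quotient.eq_zero_iff_mem.2 X_bot_mem_hallRadoIdeal
  rw [← Ideal.Quotient.eq_zero_iff_mem]
  exact (DFunLike.congr_fun h2 q).symm.trans (Ideal.Quotient.eq_zero_iff_mem.2 h1)

lemma linearIndependent_standard (d : ℕ) :
    LinearIndependent ℚ fun m : {m : M.Flats →₀ ℕ // IsStandard M.flatRank m ∧ m.degree = d} =>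
      M.simplicialMap (monomial m.1 1) := by
  classical
  rw [linearIndependent_iff']
  intro s g hg
  refine eq_zero_of_sum_hallRado_eq_zero flatRank_strictMono flatRank_bot flatRank_sup_add_inf_le
    (⊤ : M.Flats) d s (fun m => m.1) g Subtype.val_injective.injOn
    (fun m _ => ⟨m.2.1, fun _ _ => le_top, m.2.2⟩) fun w _ _ => ?_
  have h1 : M.simplicialMap (∑ m ∈ s, g m • monomial m.1 1) = 0 := by
    rw [← hg, map_sum]
    simp only [map_smul]
  have h2 := mem_hallRadoIdeal_of_simplicialMap_eq_zero h1 (monomial w 1)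
  simp only [Finset.sum_mul, smul_mul_assoc, monomial_mul, map_sum, map_smul,
    hallRadoFunctional_monomial, smul_eq_mul, mul_ite, mul_one, mul_zero] at h2
  rw [Finset.sum_filter]
  exact h2

end Independence

section HilbertSeries

open MvPolynomial

variable {α : Type*} {M : Matroid α} [M.Finite]

lemma simplicialMap_flatForm (F : M.ProperFlats) :
    M.simplicialMap (M.flatForm F.1) = Ideal.Quotient.mk M.augmentedChowIdeal (M.chowX F) := by
  classical
  -- the Möbius inverse of `-h_F`, with the value at the ground set making the total sum vanish
  let x : M.Flats → M.AugmentedChowRing := fun G => if h : G ≠ ⊤ then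
    Ideal.Quotient.mk M.augmentedChowIdeal (M.chowX ⟨G, h⟩) else
    -∑ A : M.ProperFlats, Ideal.Quotient.mk M.augmentedChowIdeal (M.chowX A)
  have hx : ∀ A : M.ProperFlats, x A.1 = Ideal.Quotient.mk M.augmentedChowIdeal (M.chowX A) :=
    fun A => dif_pos A.2
  have hsum : ∀ G : M.Flats, ∑ A with G ≤ A, M.simplicialMap (M.flatForm A) =
      ∑ A with G ≤ A, x A := by
    intro G
    rw [← map_sum, sum_flatForm, map_neg, simplicialMap_X, chowRingH, chowH, map_sum]
    have htop : (⊤ : M.Flats) ∈ Finset.univ.filter fun A => G ≤ A := by simp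
    rw [← Finset.add_sum_erase _ _ htop]
    have h1 : ∑ A ∈ (Finset.univ.filter fun A => G ≤ A).erase ⊤, x A =
        ∑ A : M.ProperFlats with G ≤ A.1,
          Ideal.Quotient.mk M.augmentedChowIdeal (M.chowX A) := by
      symm
      refine Finset.sum_bij (fun A _ => A.1) (fun A hA => ?_)
        (fun A _ B _ h => Subtype.ext h) (fun A hA => ?_) fun A _ => (hx A).symm
      · simpa [A.2] using hA
      · rw [Finset.mem_erase, Finset.mem_filter] at hA
        exact ⟨⟨A, hA.1⟩, by simpa using hA.2.2, rfl⟩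
    have h2 : x ⊤ = -∑ A : M.ProperFlats, Ideal.Quotient.mk M.augmentedChowIdeal (M.chowX A) :=
      dif_neg (by simp)
    rw [h1, h2, ← Finset.sum_filter_add_sum_filter_not Finset.univ
      (fun A : M.ProperFlats => G ≤ A.1)]
    ring
  rw [← hx]
  exact eq_of_sum_upper_eq hsum F.1

lemma simplicialMap_toSimplicial (p : M.ChowVars) :
    M.simplicialMap (M.toSimplicial p) = Ideal.Quotient.mk M.augmentedChowIdeal p := by
  have : M.simplicialMap.comp M.toSimplicial = Ideal.Quotient.mkₐ ℚ M.augmentedChowIdeal := by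
    refine MvPolynomial.algHom_ext fun v => ?_
    rcases v with F | i
    · rw [AlgHom.comp_apply]
      change M.simplicialMap (M.toSimplicial (M.chowX F)) = _
      rw [toSimplicial_chowX, simplicialMap_flatForm]
      rfl
    · rw [AlgHom.comp_apply]
      change M.simplicialMap (M.toSimplicial (M.chowY i)) = _
      rw [toSimplicial_chowY, simplicialMap_X, ← mk_chowY]
      rfl
  exact DFunLike.congr_fun this p

lemma isHomogeneous_chowH (F : M.Flats) : (M.chowH F).IsHomogeneous 1 := by
  classical
  exact IsHomogeneous.sum _ _ _ fun G _ => isHomogeneous_X ℚ _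

lemma augmentedChowGraded_eq_standardSpan (d : ℕ) :
    M.augmentedChowGraded d = M.standardSpan d := by
  apply le_antisymm
  · rintro _ ⟨p, hp, rfl⟩
    have hp' : (M.toSimplicial p).IsHomogeneous d := by
      have := IsHomogeneous.aeval (n := 1) hp
        (Sum.elim (fun F : M.ProperFlats => M.flatForm F.1) fun i : M.E => X (M.pointFlat i))
        (by
          rintro (F | i)
          · exact isHomogeneous_flatForm F.1
          · exact isHomogeneous_X ℚ _)
      rwa [one_mul] at this
    change Ideal.Quotient.mk M.augmentedChowIdeal p ∈ _
    rw [← simplicialMap_toSimplicial, (M.toSimplicial p).as_sum, map_sum]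
    refine Submodule.sum_mem _ fun m hm => ?_
    have hd : m.degree = d := by
      rw [Finsupp.degree_eq_weight_one]
      exact hp' (mem_support_iff.1 hm)
    rw [← mul_one (coeff m _), ← smul_eq_mul, ← smul_monomial, map_smul, ← hd]
    exact Submodule.smul_mem _ _ (simplicialMap_monomial_mem m)
  · refine Submodule.span_le.2 ?_
    rintro _ ⟨m, -, hd, rfl⟩
    refine ⟨aeval M.chowH (monomial m 1), ?_, (simplicialMap_eq_mk _).symm⟩
    have := (isHomogeneous_monomial (R := ℚ) (1 : ℚ) hd).aeval M.chowH isHomogeneous_chowH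
    rwa [one_mul] at this

lemma finrank_augmentedChowGraded (d : ℕ) :
    Module.finrank ℚ (M.augmentedChowGraded d) =
      ((standardAbove M.flatRank ⊥ 1).filter fun m => m.degree = d).card := by
  classical
  have hfin : ∀ m : M.Flats →₀ ℕ, m ∈ (standardAbove M.flatRank ⊥ 1).filter
      (fun m => m.degree = d) ↔ IsStandard M.flatRank m ∧ m.degree = d := fun m => by
    rw [Finset.mem_filter, mem_standardAbove, isStandardAbove_bot_one_iff flatRank_bot]
  let _ : Fintype {m : M.Flats →₀ ℕ // IsStandard M.flatRank m ∧ m.degree = d} :=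
    Fintype.subtype _ hfin
  have h := finrank_span_eq_card (linearIndependent_standard (M := M) d)
  rw [Fintype.card_of_subtype _ hfin] at h
  have hset : {p | ∃ m, IsStandard M.flatRank m ∧ m.degree = d ∧
      p = M.simplicialMap (monomial m 1)} = Set.range fun
      m : {m : M.Flats →₀ ℕ // IsStandard M.flatRank m ∧ m.degree = d} =>
        M.simplicialMap (monomial m.1 1) := by
    ext p
    constructor
    · rintro ⟨m, h1, h2, rfl⟩
      exact ⟨⟨m, h1, h2⟩, rfl⟩
    · rintro ⟨m, rfl⟩
      exact ⟨m.1, m.2.1, m.2.2, rfl⟩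
  rw [← h, augmentedChowGraded_eq_standardSpan, standardSpan, hset]

lemma augmentedChowSeries_eq :
    M.augmentedChowSeries =
      ((∑ m ∈ standardAbove M.flatRank ⊥ 1, Polynomial.X ^ m.degree : Polynomial ℤ) :
        PowerSeries ℤ) := by
  classical
  ext d
  rw [augmentedChowSeries, PowerSeries.coeff_mk, Polynomial.coeff_coe, Polynomial.finsetSum_coeff,
    finrank_augmentedChowGraded, Finset.card_filter]
  push_cast
  refine Finset.sum_congr rfl fun m _ => ?_
  rw [Polynomial.coeff_X_pow]
  exact if_congr eq_comm rfl rfl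

end HilbertSeries

end Matroid

/-! ### Isolated descents and augmented Chow polynomials -/

theorem theorem2 :
    (∀ {α : Type*} (M : Matroid α) [M.Finite] [M.Loopless] (n : ℕ), M.eRank = n →
      ∀ lam : M.Flats → M.Flats → ℕ, ChainPoset.IsRLabeling lam →
        M.augmentedChowSeries = (ChainPoset.isolatedDescentSum n lam : PowerSeries ℤ)) ∧
    (∀ {P : Type*} [PartialOrder P] [BoundedOrder P] [Fintype P] [LocallyFiniteOrder P]
        [DecidableEq P] [GradeMinOrder ℕ P] (lam : P → P → ℕ), ChainPoset.IsRLabeling lam →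
        ChainPoset.augmentedChowPolynomial P =
          ChainPoset.isolatedDescentSum (grade ℕ (⊤ : P)) lam) := by
  constructor
  · intro α M _ _ n hn lam hlam
    obtain ⟨p, hp, hsum⟩ := ChainPoset.exists_isChowFunction Matroid.flatRank_strictMono
      Matroid.flatRank_bot Matroid.flatRank_covBy hlam
    rw [Matroid.flatRank_top hn] at hsum
    rw [hsum, hp.sum_pow_mul_eq Matroid.flatRank_strictMono Matroid.flatRank_bot,
      Matroid.augmentedChowSeries_eq]
  · intro P _ _ _ _ _ _ lam hlam
    obtain ⟨p, hp, hsum⟩ := ChainPoset.exists_isChowFunction (rk := grade ℕ (α := P))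
      grade_strictMono (grade_bot (𝕆 := ℕ)) (fun a b h => (Nat.covBy_iff_add_one_eq.1
        (h.grade ℕ)).symm) hlam
    rw [hsum, hp.augmentedChowPolynomial_eq]
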